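/- Let $G$ be a finite connected graph (loops and multiple edges allowed) with edge set $E$, and fix a reference orientation of $G$. A discrete orientation is identified with a point of $\{0,1\}^E$, the coordinate of $e$ being $1$ if $e$ is directed as in the reference orientation and $0$ otherwise; a continuous orientation is a point of $[0,1]^E$, and an edge is bi-oriented in it if its coordinate lies in $(0,1)$. A cycle is the edge set of a closed walk through distinct vertices along distinct edges (a loop is a cycle); a cocycle is an inclusion-minimal nonempty cut. Each of them has two directions, which (relative to the reference orientation) are written as vectors in $\{0,\pm1\}^E$; these are the directed cycles and directed cocycles. A directed cycle or cocycle is in a discrete orientation $O$ if all of its edges are directed as in $O$. A cycle signature $\sigma$ (resp. cocycle signature $\sigma^*$) is a choice of a direction $\sigma(C)$ for each cycle $C$ (resp. $\sigma^*(C^*)$ for each cocycle $C^*$). It is acyclic if the only nonnegative real coefficients with $\sum_C a_C\,\sigma(C)=0$ (resp. $\sum_{C^*} a_{C^*}\,\sigma^*(C^*)=0$) are $a=0$. A discrete orientation is $\sigma$-compatible (resp. $\sigma^*$-compatible) if every directed cycle (resp. cocycle) in it is one of the chosen ones, and $(\sigma,\sigma^*)$-compatible if it is both. A continuous orientation $x$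 is $\sigma^*$-compatible if $x+\epsilon\,\sigma^*(C^*)\notin[0,1]^E$ for every $\epsilon>0$ and every cocycle $C^*$; let $S_{\sigma^*}$ be the set of these. Fix an acyclic cycle signature $\sigma$ and an acyclic cocycle signature $\sigma^*$ of $G$. For a spanning tree $T\subseteq E$, let $g_{\sigma,\sigma^*}(T)$ be the discrete orientation in which each $e\notin T$ is directed as in $\sigma(C(T,e))$, where $C(T,e)$ is the unique cycle in $T\cup\{e\}$, and each $e\in T$ is directed as in $\sigma^*(C^*(T,e))$, where $C^*(T,e)$ is the unique cocycle in $(E\setminus T)\cup\{e\}$. For a discrete orientation $O$ put $$\varphi_{\sigma,\sigma^*}(O)=\Bigl(T\cup\biguplus_{i\in I}C_i\Bigr)\setminus\biguplus_{j\in J}C^*_j ,$$ where $O$ is obtained from a $(\sigma,\sigma^*)$-compatible orientation $O^{cp}$ by reversing pairwise disjoint directed cycles $\vec C_i$ $(i\in I)$ and directed cocycles $\vec C^*_j$ $(j\in J)$ in $O^{cp}$, and $T$ is the spanning tree with $g_{\sigma,\sigma^*}(T)=O^{cp}$. For a discrete orientation $O$ and $S\subseteq E$, let $\mathrm{hoc}(O,S)$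 be the set of continuous orientations in which each $e\notin S$ is oriented as in $O$ and each $e\in S$ is oriented as in $O$ or bi-oriented. Then for every discrete orientation $O$ the set $\varphi_{\sigma,\sigma^*}(O)$ is well defined (such data exist and the resulting set does not depend on their choice), and $S_{\sigma^*}$ is the disjoint union $$S_{\sigma^*}=\biguplus_{\substack{O\in\{0,1\}^E\\ O\ \sigma^*\text{-compatible}}}\mathrm{hoc}\bigl(O,\,E\setminus\varphi_{\sigma,\sigma^*}(O)\bigr).$$ -/

import Mathlib

/-- A multigraph on the vertex set `V` with edge set `E` (loops and parallel edges are allowed),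
together with a reference orientation: the edge `e` has the endpoints `tail e` and `head e`, and
the reference orientation directs it from `tail e` to `head e`. -/
structure RefGraph (V E : Type*) where
  tail : E → V
  head : E → V

/-- A discrete orientation, i.e. a point of `{0,1}^E`: `true` (the coordinate `1`) means that the
edge is directed as in the reference orientation, `false` (the coordinate `0`) that it is directed
the other way. -/
abbrev DiscreteOrientation (E : Type*) := E → Bool

namespace DiscreteOrientation

variable {E : Type*}

/-- The discrete orientation as a vertex of the cube `[0,1]^E`. -/
def toReal (O : DiscreteOrientation E) : E → ℝ := fun e => if O e then 1 else 0

/-- The direction of the edge `e` in `O`, as a sign relative to the reference orientation. -/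
def sign (O : DiscreteOrientation E) (e : E) : ℤ := if O e then 1 else -1

/-- The partially directed edge set given by the `{0,±1}`-vector `c` (for instance a directed
cycle or a directed cocycle) is in the orientation `O`. -/
def Contains (O : DiscreteOrientation E) (c : E → ℤ) : Prop :=
  ∀ e, c e ≠ 0 → O.sign e = c e

/-- The orientation obtained from `O` by reversing all edges in `P`. -/
noncomputable def reverse (O : DiscreteOrientation E) (P : Set E) : DiscreteOrientation E :=
  open Classical in fun e => if e ∈ P then !O e else O e

/-- The half-open cell `hoc(O, S)`: the continuous orientations in which each edge not in `S` is
oriented as in `O`, and each edge in `S` is oriented as in `O` or bi-oriented. -/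
def hoc (O : DiscreteOrientation E) (S : Set E) : Set (E → ℝ) :=
  {x | (∀ e, e ∉ S → x e = O.toReal e) ∧
       (∀ e, e ∈ S → x e = O.toReal e ∨ x e ∈ Set.Ioo (0 : ℝ) 1)}

end DiscreteOrientation

namespace RefGraph

variable {V E : Type*} (G : RefGraph V E)

/-- The spanning subgraph `(V, S)`, stripped of loops and multiplicities. -/
def toSimple (S : Set E) : SimpleGraph V :=
  SimpleGraph.fromRel fun u v => ∃ e ∈ S, G.tail e = u ∧ G.head e = v

/-- `G` is connected (and has a vertex). -/
def Connected : Prop := (G.toSimple Set.univ).Connected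

/-- The arc on the edge `e` with sign `s` (`1`: as in the reference orientation, `-1`: opposite)
goes from `u` to `v`. For a loop both signs are possible. -/
def IsArc (e : E) (s : ℤ) (u v : V) : Prop :=
  (s = 1 ∧ G.tail e = u ∧ G.head e = v) ∨ (s = -1 ∧ G.head e = u ∧ G.tail e = v)

/-- The vector `c` is a directed cycle: it runs through distinct vertices
`v 0, …, v n` along distinct edges, `e i` going from `v i` to `v (i + 1)` (indices modulo `n + 1`),
and it vanishes off these edges. A loop is the case `n = 0`. -/
def IsDirectedCycle (c : E → ℤ) : Prop :=
  ∃ (n : ℕ) (v : Fin (n + 1) → V) (e : Fin (n + 1) → E),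
    Function.Injective v ∧ Function.Injective e ∧
    (∀ i, G.IsArc (e i) (c (e i)) (v i) (v (i + 1))) ∧
    Function.support c = Set.range e

/-- A cycle is the edge set of a directed cycle. -/
def IsCycle (C : Set E) : Prop := ∃ c, G.IsDirectedCycle c ∧ Function.support c = C

/-- The set of edges with one endpoint in `W` and the other one not in `W`. -/
def cut (W : Set V) : Set E :=
  {e | (G.tail e ∈ W ∧ G.head e ∉ W) ∨ (G.tail e ∉ W ∧ G.head e ∈ W)}

/-- The edges of the cut of `W`, directed from `W` to its complement, as a `{0,±1}`-vector. -/
noncomputable def directedCut (W : Set V) : E → ℤ :=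
  open Classical in fun e =>
    if G.tail e ∈ W ∧ G.head e ∉ W then 1
    else if G.tail e ∉ W ∧ G.head e ∈ W then -1
    else 0

/-- A cocycle is a cut that is minimal for inclusion among the nonempty cuts. -/
def IsCocycle (C : Set E) : Prop :=
  Minimal (fun D : Set E => D.Nonempty ∧ ∃ W : Set V, G.cut W = D) C

/-- A directed cocycle: all edges of a cocycle directed from one side `W` to the other. (The
opposite direction comes from the complement of `W`.) -/
def IsDirectedCocycle (d : E → ℤ) : Prop :=
  ∃ W : Set V, G.IsCocycle (G.cut W) ∧ G.directedCut W = d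

/-- A cycle signature: the choice of a direction for each cycle. -/
structure CycleSignature where
  dir : {C : Set E // G.IsCycle C} → E → ℤ
  isDirectedCycle : ∀ C, G.IsDirectedCycle (dir C)
  support_dir : ∀ C, Function.support (dir C) = C

/-- A cocycle signature: the choice of a direction for each cocycle. -/
structure CocycleSignature where
  dir : {C : Set E // G.IsCocycle C} → E → ℤ
  isDirectedCocycle : ∀ C, G.IsDirectedCocycle (dir C)
  support_dir : ∀ C, Function.support (dir C) = C

/-- A spanning tree, as a set of edges: it connects all vertices and contains no cycle. -/
def IsSpanningTree (T : Set E) : Prop :=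
  (G.toSimple T).Connected ∧ ∀ C, G.IsCycle C → ¬ C ⊆ T

variable {G}

namespace CycleSignature

variable (σ : G.CycleSignature)

open Classical in
/-- The only nonnegative real combination of the chosen directed cycles that vanishes is the
trivial one. -/
def IsAcyclic [Fintype E] : Prop :=
  ∀ a : {C : Set E // G.IsCycle C} → ℝ, (∀ C, 0 ≤ a C) →
    (∀ e, ∑ C, a C * (σ.dir C e : ℝ) = 0) → ∀ C, a C = 0

/-- A discrete orientation is `σ`-compatible if every directed cycle in it is in `σ`. -/
def Compatible (O : DiscreteOrientation E) : Prop :=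
  ∀ c, G.IsDirectedCycle c → O.Contains c → c ∈ Set.range σ.dir

end CycleSignature

namespace CocycleSignature

variable (σs : G.CocycleSignature)

open Classical in
/-- The only nonnegative real combination of the chosen directed cocycles that vanishes is the
trivial one. -/
def IsAcyclic [Fintype E] : Prop :=
  ∀ a : {C : Set E // G.IsCocycle C} → ℝ, (∀ C, 0 ≤ a C) →
    (∀ e, ∑ C, a C * (σs.dir C e : ℝ) = 0) → ∀ C, a C = 0

/-- A discrete orientation is `σ*`-compatible if every directed cocycle in it is in `σ*`. -/
def Compatible (O : DiscreteOrientation E) : Prop :=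
  ∀ d, G.IsDirectedCocycle d → O.Contains d → d ∈ Set.range σs.dir

/-- The set `S_{σ*}` of `σ*`-compatible continuous orientations: the points of the cube `[0,1]^E`
that leave the cube when moved by any positive amount along any directed cocycle in `σ*`. -/
def continuousCompatible : Set (E → ℝ) :=
  {x | x ∈ Set.Icc (0 : E → ℝ) 1 ∧
    ∀ ε : ℝ, 0 < ε → ∀ C, (fun e => x e + ε * (σs.dir C e : ℝ)) ∉ Set.Icc (0 : E → ℝ) 1}

end CocycleSignature

variable (σ : G.CycleSignature) (σs : G.CocycleSignature)

/-- `O` is the orientation `g_{σ,σ*}(T)` attached to the spanning tree `T`: each `e ∉ T` is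
oriented as in `σ(C(T, e))`, where the fundamental cycle `C(T, e)` is the cycle in `T ∪ {e}`, and
each `e ∈ T` is oriented as in `σ*(C*(T, e))`, where the fundamental cocycle `C*(T, e)` is the
cocycle in `(E ∖ T) ∪ {e}`. -/
def IsTreeOrientation (T : Set E) (O : DiscreteOrientation E) : Prop :=
  G.IsSpanningTree T ∧
  (∀ e, e ∉ T → ∃ C : {C : Set E // G.IsCycle C},
    C.1 ⊆ T ∪ {e} ∧ σ.dir C e = O.sign e) ∧
  (∀ e, e ∈ T → ∃ C : {C : Set E // G.IsCocycle C},
    C.1 ⊆ Tᶜ ∪ {e} ∧ σs.dir C e = O.sign e)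

/-- The defining relation of `φ_{σ,σ*}(O) = S`: the orientation `O` is obtained from a
`(σ,σ*)`-compatible orientation `Ocp` by reversing pairwise disjoint directed cycles (the members of
`I`) and directed cocycles (the members of `J`) in `Ocp`, the spanning tree `T` satisfies
`g_{σ,σ*}(T) = Ocp`, and `S = (T ∪ ⋃ C_i) ∖ ⋃ C*_j`. -/
def IsPhiImage (O : DiscreteOrientation E) (S : Set E) : Prop :=
  ∃ (Ocp : DiscreteOrientation E) (T : Set E) (I J : Set (E → ℤ)),
    σ.Compatible Ocp ∧ σs.Compatible Ocp ∧
    IsTreeOrientation σ σs T Ocp ∧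
    (∀ c ∈ I, G.IsDirectedCycle c ∧ Ocp.Contains c) ∧
    (∀ d ∈ J, G.IsDirectedCocycle d ∧ Ocp.Contains d) ∧
    (I ∪ J).PairwiseDisjoint Function.support ∧
    O = Ocp.reverse ((⋃ c ∈ I, Function.support c) ∪ ⋃ d ∈ J, Function.support d) ∧
    S = (T ∪ ⋃ c ∈ I, Function.support c) \ ⋃ d ∈ J, Function.support d

/-- The map `φ_{σ,σ*}` from discrete orientations to spanning subgraphs (sets of edges): the set
singled out by its defining relation. -/
noncomputable def phi (O : DiscreteOrientation E) : Set E :=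
  Classical.epsilon (IsPhiImage σ σs O)

/-- The dual map `φ*_{σ,σ*}`, `O ↦ E ∖ φ_{σ,σ*}(O)`. -/
noncomputable def phiDual (O : DiscreteOrientation E) : Set E := (phi σ σs O)ᶜ

end RefGraph

/-! By Gordan's alternative an acyclic signature is induced by a weight: there are `w`, `w'` with `w
· σ(C) > 0` for all cycles and `w' · σ*(C*) > 0` for all cocycles. Compatibility of an orientation
becomes positivity of `w` or `w'` on the directed cycles or cocycles in it. These are the elementary
vectors of two orthogonal spaces, the cycle space `Z` and the cut space `B`: every nonzero vector of
`Z` or `B` has one conforming to it (`isElementarySystem_cycle`, `isElementarySystem_cocycle`).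

Data for `φ` exist because maximizing the weight within a reversal class gives a compatible
orientation (`exists_compatible_reversal`), and a compatible orientation poses a linear program,
with cost `w` up to `B` and feasible points in `w' + Z` nonnegative along the orientation, whose
minimizer has a spanning tree as support (`exists_isTreeOrientation`).

The heart is `PhiCertificate.eq_of_agree`. The tree yields `x ∈ w' + Z` supported on `T` and `y ∈ w
+ B` supported off `T`, both with the signs of the compatible orientation. Reversals are recorded by
subtracting a large multiple of the signed indicators of the reversed parts: `X = x - M z`, `Y = y -
M b` with `z ∈ Z`, `b ∈ B`. For two orientations, `X₁ - X₂ ∈ Z` and `Y₁ - Y₂ ∈ B` are orthogonal;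
yet if the orientations differ only at edges lying in both images or in neither, every coordinate
product `(X₁ - X₂)(Y₁ - Y₂)` is nonpositive. So all products vanish, which forces all the data to
coincide.

This separation property gives uniqueness of `φ(O)`, disjointness of the cells, and, by a pigeonhole
argument over the orientations of the bi-oriented edges, a covering of the whole cube
(`exists_mem_hoc_compl`). Compatibility selects the right cells: for compatible `O` the vector `X`
is supported on `φ(O)`, has the signs of `O` there, and pairs positively with every chosen cocycle,
so it obstructs moving inside the cube; conversely, directing the bi-oriented edges of a compatible
continuous orientation cannot create a directed cocycle against `σ*`. -/

/-- Gordan's alternative relative to a subspace: if no nontrivial nonnegative combination of the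
`v i` lies in `U`, then some functional vanishes on `U` and is positive on every `v i`. -/
theorem exists_linearMap_pos_of_sum_notMem {ι F : Type*} [Fintype ι] [NormedAddCommGroup F]
    [NormedSpace ℝ F] [FiniteDimensional ℝ F] (U : Submodule ℝ F) (v : ι → F)
    (h : ∀ a : ι → ℝ, (∀ i, 0 ≤ a i) → ∑ i, a i • v i ∈ U → ∀ i, a i = 0) :
    ∃ f : F →ₗ[ℝ] ℝ, (∀ z ∈ U, f z = 0) ∧ ∀ i, 0 < f (v i) := by
  classical
  let L : (ι → ℝ) →ₗ[ℝ] F := Fintype.linearCombination ℝ v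
  have hL : ∀ a, L a = ∑ i, a i • v i := fun a => Fintype.linearCombination_apply ℝ v a
  have hcont : Continuous L := L.continuous_of_finiteDimensional
  have hdisj : Disjoint (L '' stdSimplex ℝ ι) (U : Set F) := by
    rw [Set.disjoint_left]
    rintro _ ⟨a, ha, rfl⟩ hU
    have h0 := h a ha.1 (by rw [← hL]; exact hU)
    have h1 := ha.2
    simp [h0] at h1
  -- Normalized combinations form a compact convex set, which is separated strictly from the closed
  -- subspace `U`.
  obtain ⟨f, r, t, hr, hrt, ht⟩ := geometric_hahn_banach_compact_closed
    ((convex_stdSimplex ℝ ι).linear_image L) ((isCompact_stdSimplex ℝ ι).image hcont)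
    U.convex U.closed_of_finiteDimensional hdisj
  have ht0 : t < 0 := by simpa using ht 0 U.zero_mem
  have hzero : ∀ z ∈ U, f z = 0 := by
    intro z hz
    by_contra hne
    -- A functional bounded below on a subspace vanishes there: rescaling `z` would reach the
    -- excluded value `t`.
    have h1 := ht ((t / f z) • z) (U.smul_mem _ hz)
    rw [map_smul, smul_eq_mul, div_mul_cancel₀ _ hne] at h1
    exact lt_irrefl _ h1
  refine ⟨-f.toLinearMap, fun z hz => by simp [hzero z hz], fun i => ?_⟩
  have hi : L (Pi.single i 1) = v i := by simp [L]
  have h1 := hr (v i) ⟨Pi.single i 1, single_mem_stdSimplex ℝ i, hi⟩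
  simp only [LinearMap.neg_apply, ContinuousLinearMap.coe_coe]
  linarith

/-! ### Elementary vectors, conformal decomposition and reversal classes -/

section Elementary

variable {E : Type*}

/-- An integer vector as a real vector. -/
def toVec (c : E → ℤ) : E → ℝ := fun e => (c e : ℝ)

@[simp] theorem toVec_apply (c : E → ℤ) (e : E) : toVec c e = c e := rfl

@[simp] theorem toVec_neg (c : E → ℤ) : toVec (-c) = -toVec c := by
  funext e; simp

theorem DiscreteOrientation.sign_eq_or (O : DiscreteOrientation E) (e : E) :
    O.sign e = 1 ∨ O.sign e = -1 := by
  unfold DiscreteOrientation.sign; split_ifs <;> simp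

theorem DiscreteOrientation.sign_mul_self (O : DiscreteOrientation E) (e : E) :
    (O.sign e : ℝ) * O.sign e = 1 := by
  rcases O.sign_eq_or e with h | h <;> simp [h]

theorem DiscreteOrientation.sign_eq_iff (O O' : DiscreteOrientation E) (e : E) :
    O.sign e = O'.sign e ↔ O e = O' e := by
  unfold DiscreteOrientation.sign
  cases O e <;> cases O' e <;> simp

theorem DiscreteOrientation.reverse_apply_mem (O : DiscreteOrientation E) {P : Set E} {e : E}
    (h : e ∈ P) : O.reverse P e = !O e := by simp [DiscreteOrientation.reverse, h]

theorem DiscreteOrientation.reverse_apply_notMem (O : DiscreteOrientation E) {P : Set E} {e : E}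
    (h : e ∉ P) : O.reverse P e = O e := by simp [DiscreteOrientation.reverse, h]

theorem DiscreteOrientation.sign_reverse_mem (O : DiscreteOrientation E) {P : Set E} {e : E}
    (h : e ∈ P) : (O.reverse P).sign e = -O.sign e := by
  simp only [DiscreteOrientation.sign, O.reverse_apply_mem h]
  cases O e <;> simp

theorem DiscreteOrientation.sign_reverse_notMem (O : DiscreteOrientation E) {P : Set E} {e : E}
    (h : e ∉ P) : (O.reverse P).sign e = O.sign e := by
  simp only [DiscreteOrientation.sign, O.reverse_apply_notMem h]

theorem DiscreteOrientation.toReal_eq (O : DiscreteOrientation E) (e : E) :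
    O.toReal e = ((O.sign e : ℝ) + 1) / 2 := by
  unfold DiscreteOrientation.toReal DiscreteOrientation.sign
  split_ifs <;> norm_num

/-- `P` is a symmetric class of `{0,±1}`-vectors in the subspace `U` that are determined up to sign
by their supports, and every nonzero vector of `U` conforms to one of them. -/
structure IsElementarySystem (P : (E → ℤ) → Prop) (U : Submodule ℝ (E → ℝ)) : Prop where
  mem : ∀ c, P c → toVec c ∈ U
  values : ∀ c, P c → ∀ e, c e = 0 ∨ c e = 1 ∨ c e = -1
  neg : ∀ c, P c → P (-c)
  nonzero : ∀ c, P c → ∃ e, c e ≠ 0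
  conformal : ∀ z ∈ U, z ≠ 0 → ∃ c, P c ∧ ∀ e, c e ≠ 0 → 0 < (c e : ℝ) * z e
  eq_or_neg : ∀ c c', P c → P c' → Function.support c = Function.support c' → c = c' ∨ c = -c'

variable [Fintype E]

/-- The weight vector `w` is positive on each member of `P` contained in `O`. -/
def WeightCompatible (P : (E → ℤ) → Prop) (w : E → ℝ) (O : DiscreteOrientation E) : Prop :=
  ∀ c, P c → O.Contains c → 0 < w ⬝ᵥ toVec c

namespace IsElementarySystem

variable {P : (E → ℤ) → Prop} {U : Submodule ℝ (E → ℝ)}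

/-- If all members of `P` in `O` have positive weight, then so has every nonzero vector of `U`
that conforms to `O`. -/
theorem dotProduct_pos (h : IsElementarySystem P U) {w : E → ℝ} {O : DiscreteOrientation E}
    (hw : WeightCompatible P w O) {z : E → ℝ} (hz : z ∈ U) (hO : ∀ e, 0 ≤ (O.sign e : ℝ) * z e)
    (hne : z ≠ 0) : 0 < w ⬝ᵥ z := by
  classical
  induction hn : (Finset.univ.filter fun e => z e ≠ 0).card using Nat.strong_induction_on
    generalizing z with
  | _ n ih =>
    obtain ⟨c, hc, hcz⟩ := h.conformal z hz hne
    have hcO : O.Contains c := by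
      intro e he
      have h1 := hcz e he
      have h2 := hO e
      rcases h.values c hc e with h3 | h3 | h3
      · exact absurd h3 he
      · rcases O.sign_eq_or e with h4 | h4
        · rw [h3, h4]
        · rw [h3] at h1; rw [h4] at h2; push_cast at h1 h2; linarith
      · rcases O.sign_eq_or e with h4 | h4
        · rw [h3] at h1; rw [h4] at h2; push_cast at h1 h2; linarith
        · rw [h3, h4]
    have hwc := hw c hc hcO
    obtain ⟨e₁, he₁⟩ := h.nonzero c hc
    -- `e₀` minimizes `|z|` on the support of `c`; subtracting that multiple of `c` kills `e₀` and
    -- preserves conformity to `O`, so the support shrinks.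
    obtain ⟨e₀, he₀, hmin⟩ := Finset.exists_min_image (Finset.univ.filter fun e => c e ≠ 0)
      (fun e => (O.sign e : ℝ) * z e) ⟨e₁, by simpa using he₁⟩
    have he₀ : c e₀ ≠ 0 := by simpa using he₀
    set t := (O.sign e₀ : ℝ) * z e₀ with ht
    have htpos : 0 < t := by
      have := hcz e₀ he₀
      rwa [← hcO e₀ he₀] at this
    have hz' : z - t • toVec c ∈ U := U.sub_mem hz (U.smul_mem _ (h.mem c hc))
    have hO' : ∀ e, 0 ≤ (O.sign e : ℝ) * (z - t • toVec c) e := by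
      intro e
      by_cases he : c e = 0
      · simpa [he] using hO e
      · have h1 := hmin e (by simpa using he)
        have h2 := O.sign_mul_self e
        have h3 : (c e : ℝ) = O.sign e := by rw [hcO e he]
        simp only [Pi.sub_apply, Pi.smul_apply, toVec_apply, smul_eq_mul, h3]
        nlinarith
    have hdot : w ⬝ᵥ z = w ⬝ᵥ (z - t • toVec c) + t * (w ⬝ᵥ toVec c) := by
      rw [dotProduct_sub, dotProduct_smul, smul_eq_mul]; ring
    have hpos := mul_pos htpos hwc
    by_cases hzero : z - t • toVec c = 0
    · rw [hdot, hzero, dotProduct_zero]; linarith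
    · have hlt : (Finset.univ.filter fun e => (z - t • toVec c) e ≠ 0).card < n := by
        rw [← hn]
        refine Finset.card_lt_card (Finset.ssubset_iff_of_subset ?_ |>.2 ⟨e₀, ?_, ?_⟩)
        · intro e he
          simp only [Finset.mem_filter, Finset.mem_univ, true_and] at he ⊢
          intro h0
          by_cases hce : c e = 0
          · exact he (by simp [hce, h0])
          · have := hcz e hce
            rw [h0] at this; simp at this
        · simp only [Finset.mem_filter, Finset.mem_univ, true_and]
          intro h0
          have := hcz e₀ he₀
          rw [h0] at this; simp at this
        · simp only [Finset.mem_filter, Finset.mem_univ, true_and, not_not]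
          have h2 := O.sign_mul_self e₀
          simp only [Pi.sub_apply, Pi.smul_apply, toVec_apply, smul_eq_mul, ht, ← hcO e₀ he₀]
          linear_combination (-z e₀) * h2
      have := ih _ hlt hz' hO' hzero rfl
      linarith

/-- A weight vector that is positive on the members of `P` in `O` agrees on `U` with a vector
whose coordinates all have the signs of `O`. -/
theorem exists_positive_representative (h : IsElementarySystem P U) {w : E → ℝ}
    {O : DiscreteOrientation E} (hw : WeightCompatible P w O) :
    ∃ g : E → ℝ, (∀ e, 0 < (O.sign e : ℝ) * g e) ∧ ∀ z ∈ U, g ⬝ᵥ z = w ⬝ᵥ z := by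
  classical
  let φ : (E → ℝ) →ₗ[ℝ] ℝ :=
    { toFun := fun z => w ⬝ᵥ z
      map_add' := fun a b => dotProduct_add w a b
      map_smul' := fun r a => by simp [dotProduct_smul] }
  -- A nonnegative combination lying in the graph of `-φ` is a pair `(z, -w·z)` with `z` conforming
  -- to `O` and `w·z ≤ 0`, hence zero by `dotProduct_pos`. The functional `f` that results, divided
  -- by `f (0, 1)`, is `w` on `U`; the generators `O.sign e` times a unit vector give its
  -- coordinates their signs.
  let v : Option E → (E → ℝ) × ℝ := fun o =>
    o.elim (0, 1) fun e => (Pi.single e (O.sign e : ℝ), 0)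
  have hsum : ∀ a : Option E → ℝ, ∑ i, a i • v i =
      ((fun e => a (some e) * O.sign e), a none) := by
    intro a
    rw [Fintype.sum_option]
    ext
    · simp [v, Prod.fst_sum, Finset.sum_apply, Pi.single_apply]
    · simp [v, Prod.snd_sum]
  obtain ⟨f, hf0, hfpos⟩ := exists_linearMap_pos_of_sum_notMem
    (U.map (LinearMap.prod LinearMap.id (-φ))) v (by
      intro a ha hmem
      rw [hsum] at hmem
      obtain ⟨z, hz, hze⟩ := hmem
      have h1 : z = fun e => a (some e) * O.sign e := congrArg Prod.fst hze
      have h2 : -(φ z) = a none := congrArg Prod.snd hze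
      have hz0 : z = 0 := by
        by_contra hne
        have h3 := h.dotProduct_pos hw hz (fun e => by
          rw [h1]
          have := O.sign_mul_self e
          have := ha (some e)
          nlinarith) hne
        have h4 := ha none
        have h5 : φ z = w ⬝ᵥ z := rfl
        linarith
      rintro (_ | e)
      · rw [← h2, hz0]; simp
      · have h6 := congrFun h1 e
        rw [hz0] at h6
        have h7 : (O.sign e : ℝ) ≠ 0 := by
          intro h8; have := O.sign_mul_self e; rw [h8] at this; simp at this
        simpa [h7] using h6.symm)
  have ht : 0 < f (0, 1) := hfpos none
  have hz : ∀ z ∈ U, f (z, 0) = f (0, 1) * (w ⬝ᵥ z) := by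
    intro z hz
    have h1 := hf0 (z, -(w ⬝ᵥ z)) ⟨z, hz, rfl⟩
    have h2 : ((z, -(w ⬝ᵥ z)) : (E → ℝ) × ℝ) = (z, 0) + (-(w ⬝ᵥ z)) • ((0 : E → ℝ), (1 : ℝ)) := by
      ext <;> simp
    rw [h2, map_add, map_smul, smul_eq_mul] at h1
    linarith
  refine ⟨fun e => f (Pi.single e 1, 0) / f (0, 1), fun e => ?_, fun z hzU => ?_⟩
  · have h1 := hfpos (some e)
    have h2 : v (some e) = (O.sign e : ℝ) • ((Pi.single e 1 : E → ℝ), (0 : ℝ)) := by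
      ext
      · simp [v, Pi.single_apply]
      · simp [v]
    rw [h2, map_smul, smul_eq_mul] at h1
    rw [← mul_div_assoc]
    exact div_pos h1 ht
  · have h1 : f (z, 0) = ∑ e, f (Pi.single e 1, 0) * z e := by
      have := LinearMap.pi_apply_eq_sum_univ (f.comp (LinearMap.inl ℝ (E → ℝ) ℝ)) z
      simp only [LinearMap.comp_apply, LinearMap.inl_apply, smul_eq_mul] at this
      rw [this]
      refine Finset.sum_congr rfl fun e _ => ?_
      rw [mul_comm]
      congr 3
      funext e'
      simp [Pi.single_apply, eq_comm]
    have h2 := hz z hzU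
    rw [h1] at h2
    simp only [dotProduct] at h2 ⊢
    simp only [div_mul_eq_mul_div, ← Finset.sum_div]
    rw [h2]
    field_simp

/-- A `{0,±1}`-vector of `U` is a sum of members of `P` with disjoint supports. -/
theorem exists_disjoint_decomposition (h : IsElementarySystem P U) (u : E → ℤ)
    (hval : ∀ e, u e = 0 ∨ u e = 1 ∨ u e = -1) (hu : toVec u ∈ U) :
    ∃ I : Set (E → ℤ), (∀ c ∈ I, P c ∧ ∀ e, c e ≠ 0 → c e = u e) ∧
      I.PairwiseDisjoint Function.support ∧ ⋃ c ∈ I, Function.support c = Function.support u := by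
  classical
  induction hn : (Finset.univ.filter fun e => u e ≠ 0).card using Nat.strong_induction_on
    generalizing u with
  | _ n ih =>
    by_cases hne : toVec u = 0
    · refine ⟨∅, by simp, by simp, ?_⟩
      have : u = 0 := by
        funext e
        have := congrFun hne e
        simpa using this
      simp [this]
    obtain ⟨c, hc, hcu⟩ := h.conformal _ hu hne
    have hcu' : ∀ e, c e ≠ 0 → c e = u e := by
      intro e he
      have h1 := hcu e he
      rw [toVec_apply] at h1
      have h1 : 0 < c e * u e := by exact_mod_cast h1
      rcases h.values c hc e with h2 | h2 | h2 <;> rcases hval e with h3 | h3 | h3 <;>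
        simp_all
    obtain ⟨e₀, he₀⟩ := h.nonzero c hc
    -- Since entries are `0, ±1`, subtracting a conforming `c` erases `u` exactly on the support of
    -- `c`; the later summands are therefore disjoint from `c`.
    have hsub : ∀ e, (u - c) e = if c e = 0 then u e else 0 := by
      intro e
      split_ifs with he
      · simp [he]
      · simp [hcu' e he]
    obtain ⟨I, hI, hdisj, hun⟩ := ih (Finset.univ.filter fun e => (u - c) e ≠ 0).card (by
        rw [← hn]
        refine Finset.card_lt_card (Finset.ssubset_iff_of_subset ?_ |>.2 ⟨e₀, ?_, ?_⟩)
        · intro e he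
          simp only [Finset.mem_filter, Finset.mem_univ, true_and, hsub] at he ⊢
          split_ifs at he with h1
          · exact he
          · exact absurd rfl he
        · simpa [← hcu' e₀ he₀] using he₀
        · simp [hsub, he₀]) (u - c)
      (fun e => by rw [hsub]; split_ifs; exacts [hval e, Or.inl rfl])
      (by
        have : toVec (u - c) = toVec u - toVec c := by funext e; simp
        rw [this]; exact U.sub_mem hu (h.mem c hc)) rfl
    have hIc : ∀ d ∈ I, ∀ e, d e ≠ 0 → c e = 0 := by
      intro d hd e he
      by_contra hce
      have := (hI d hd).2 e he
      rw [hsub, if_neg hce] at this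
      exact he this
    refine ⟨insert c I, ?_, ?_, ?_⟩
    · rintro d (rfl | hd)
      · exact ⟨hc, hcu'⟩
      · refine ⟨(hI d hd).1, fun e he => ?_⟩
        rw [(hI d hd).2 e he, hsub, if_pos (hIc d hd e he)]
    · rw [Set.pairwiseDisjoint_insert]
      refine ⟨hdisj, fun d hd _ => Set.disjoint_left.2 fun e hce hde => ?_⟩
      exact hce (hIc d hd e hde)
    · rw [Set.biUnion_insert, hun]
      ext e
      simp only [Set.mem_union, Function.mem_support, hsub]
      by_cases he : c e = 0
      · simp [he]
      · simp [he, ← hcu' e he]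

/-- The signs of `O` on a union of disjoint members of `P` contained in `O` form a vector of
`U`. -/
theorem indicator_biUnion_mem (h : IsElementarySystem P U) (O : DiscreteOrientation E)
    {I : Set (E → ℤ)} (hI : ∀ c ∈ I, P c ∧ O.Contains c)
    (hdisj : I.PairwiseDisjoint Function.support) :
    (⋃ c ∈ I, Function.support c).indicator (fun e => (O.sign e : ℝ)) ∈ U := by
  classical
  -- Members contained in `O` are determined by their supports, of which there are finitely many.
  have hfin : I.Finite := by
    refine Set.Finite.of_finite_image (f := Function.support) (Set.toFinite _) ?_
    intro c hc d hd hcd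
    funext e
    by_cases he : c e = 0
    · have : d e = 0 := by
        by_contra h1
        have : e ∈ Function.support c := by
          rw [hcd]; exact h1
        exact this he
      rw [he, this]
    · have : d e ≠ 0 := by
        have : e ∈ Function.support d := by rw [← hcd]; exact he
        exact this
      rw [← (hI c hc).2 e he, ← (hI d hd).2 e this]
  have hsum : (⋃ c ∈ I, Function.support c).indicator (fun e => (O.sign e : ℝ)) =
      ∑ c ∈ hfin.toFinset, toVec c := by
    funext e
    rw [Finset.sum_apply]
    by_cases he : e ∈ ⋃ c ∈ I, Function.support c
    · rw [Set.indicator_of_mem he]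
      simp only [Set.mem_iUnion, exists_prop] at he
      obtain ⟨c, hc, hce⟩ := he
      rw [Finset.sum_eq_single c]
      · rw [(hI c hc).2 e hce, toVec_apply]
      · intro d hd hdc
        by_contra hne
        have hde : e ∈ Function.support d := by simpa using hne
        exact Set.disjoint_left.1 (hdisj (hfin.mem_toFinset.1 hd) hc hdc) hde hce
      · intro hc'
        exact absurd (hfin.mem_toFinset.2 hc) hc'
    · rw [Set.indicator_of_notMem he, Finset.sum_eq_zero]
      intro c hc
      by_contra hne
      refine he (Set.mem_biUnion (hfin.mem_toFinset.1 hc) ?_)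
      simpa using hne
  rw [hsum]
  exact U.sum_mem fun c hc => h.mem c (hI c (hfin.mem_toFinset.1 hc)).1

/-- Every orientation arises from a compatible one by reversing disjoint members of `P`. -/
theorem exists_compatible_reversal (h : IsElementarySystem P U) {w : E → ℝ}
    (hw : ∀ c, P c → w ⬝ᵥ toVec c ≠ 0) (O : DiscreteOrientation E) :
    ∃ (O' : DiscreteOrientation E) (I : Set (E → ℤ)), WeightCompatible P w O' ∧
      (∀ c ∈ I, P c ∧ O'.Contains c) ∧ I.PairwiseDisjoint Function.support ∧
      O = O'.reverse (⋃ c ∈ I, Function.support c) := by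
  classical
  -- Reversing a member `c` in `O'` moves the cube vertex by `-c`, inside the same coset of `U`. At
  -- a vertex of maximal weight, no such `c` has negative weight.
  obtain ⟨O', hO', hmax⟩ := Finset.exists_max_image
    (Finset.univ.filter fun O' : DiscreteOrientation E => O'.toReal - O.toReal ∈ U)
    (fun O' => w ⬝ᵥ O'.toReal) ⟨O, by simp⟩
  have hO' : O'.toReal - O.toReal ∈ U := by simpa using hO'
  let u : E → ℤ := fun e => if O' e = O e then 0 else O'.sign e
  have hu : toVec u = O'.toReal - O.toReal := by
    funext e
    simp only [toVec_apply, u, Pi.sub_apply, DiscreteOrientation.toReal,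
      DiscreteOrientation.sign]
    cases O' e <;> cases O e <;> simp
  obtain ⟨I, hI, hdisj, hun⟩ := h.exists_disjoint_decomposition u (fun e => by
    simp only [u]
    split_ifs
    · exact Or.inl rfl
    · exact Or.inr (O'.sign_eq_or e)) (hu ▸ hO')
  refine ⟨O', I, ?_, fun c hc => ⟨(hI c hc).1, fun e he => ?_⟩, hdisj, ?_⟩
  · intro c hc hcO
    refine lt_of_le_of_ne ?_ (hw c hc).symm
    have hrev : (O'.reverse (Function.support c)).toReal = O'.toReal - toVec c := by
      funext e
      rw [Pi.sub_apply, DiscreteOrientation.toReal_eq, DiscreteOrientation.toReal_eq, toVec_apply]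
      by_cases he : c e = 0
      · rw [O'.sign_reverse_notMem (by simpa using he), he]; simp
      · rw [O'.sign_reverse_mem (by simpa using he), hcO e he]; push_cast; ring
    have h1 := hmax (O'.reverse (Function.support c)) (by
      simp only [Finset.mem_filter, Finset.mem_univ, true_and]
      rw [hrev, sub_right_comm]
      exact U.sub_mem hO' (h.mem c hc))
    rw [hrev, dotProduct_sub] at h1
    linarith
  · have h1 := (hI c hc).2 e he
    rw [h1]
    simp only [u] at h1 ⊢
    split_ifs at h1 ⊢ with h2
    · exact absurd h1 he
    · rfl
  · rw [hun]
    funext e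
    by_cases he : O' e = O e
    · rw [O'.reverse_apply_notMem (by simp [u, he]), he]
    · have h1 : O'.sign e ≠ 0 := by rcases O'.sign_eq_or e with h1 | h1 <;> simp [h1]
      rw [O'.reverse_apply_mem (by simp [u, he, h1])]
      revert he; cases O' e <;> cases O e <;> simp

end IsElementarySystem

end Elementary

/-! ### Certificates and the separation property of `φ` -/

section Certificate

variable {E : Type*}

/-- The linear algebra data behind `φ(O) = S`: a compatible orientation `base`, the tree `T`, the
reversed parts `A` (cycles) and `D` (cocycles), the tree solutions `x` and `y` of the two dual
systems, and the vectors `z`, `b` of the reversed parts. -/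
structure PhiCertificate (Z B : Submodule ℝ (E → ℝ)) (w w' : E → ℝ) (O : DiscreteOrientation E)
    (S : Set E) where
  base : DiscreteOrientation E
  (T A D : Set E)
  (x y z b : E → ℝ)
  x_mem : x - w' ∈ Z
  y_mem : y - w ∈ B
  z_mem : z ∈ Z
  b_mem : b ∈ B
  disj : ∀ e ∈ A, e ∉ D
  x_pos : ∀ e ∈ T, 0 < (base.sign e : ℝ) * x e
  x_zero : ∀ e, e ∉ T → x e = 0
  y_pos : ∀ e, e ∉ T → 0 < (base.sign e : ℝ) * y e
  y_zero : ∀ e ∈ T, y e = 0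
  z_on : ∀ e ∈ A, z e = base.sign e
  z_off : ∀ e, e ∉ A → z e = 0
  b_on : ∀ e ∈ D, b e = base.sign e
  b_off : ∀ e, e ∉ D → b e = 0
  orient : O = base.reverse (A ∪ D)
  S_eq : S = (T ∪ A) \ D
  tree_indep : ∀ z ∈ Z, (∀ e, e ∉ T → z e = 0) → z = 0
  tree_span : ∀ b ∈ B, (∀ e ∈ T, b e = 0) → b = 0

namespace PhiCertificate

variable {Z B : Submodule ℝ (E → ℝ)} {w w' : E → ℝ} {O O₁ O₂ : DiscreteOrientation E}
  {S S₁ S₂ : Set E}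

/-- The possible values `ξ`, `η` of the two solutions at an edge, relative to its direction, when
the edge is in the image; `M` is a large number and `K` bounds the tree solutions. -/
def InImage (M K ξ η : ℝ) : Prop :=
  (∃ a b, ξ = M - a ∧ η = -b ∧ 0 ≤ a ∧ a ≤ K ∧ 0 ≤ b ∧ a * b = 0 ∧ 0 < a + b) ∨
    (η = 0 ∧ 0 < ξ ∧ ξ ≤ K)

theorem InImage.signs {M K ξ η : ℝ} (hM : 2 * K < M) (hK : 0 ≤ K) (h : InImage M K ξ η) :
    0 < ξ ∧ η ≤ 0 := by
  rcases h with ⟨a, b, rfl, rfl, h⟩ | ⟨h1, h2, h3⟩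
  · exact ⟨by linarith, by linarith⟩
  · exact ⟨h2, h1.le⟩

/-- The admissible points `(ξ, η)` lie on the L-shaped curve made of `η = 0, ξ < M` and `ξ = M, η <
0`, with the corner excluded. Along it `η` decreases weakly as `ξ` grows, so the product is
nonpositive, and it is strictly negative for points on different arms. -/
theorem InImage.mul_sub_sub {M K ξ₁ η₁ ξ₂ η₂ : ℝ} (hM : 2 * K < M)
    (h₁ : InImage M K ξ₁ η₁) (h₂ : InImage M K ξ₂ η₂) :
    (ξ₁ - ξ₂) * (η₁ - η₂) ≤ 0 ∧ ((ξ₁ - ξ₂) * (η₁ - η₂) = 0 → (η₁ = 0 ↔ η₂ = 0)) := by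
  rcases h₁ with ⟨a₁, b₁, rfl, rfl, ha₁, hK₁, hb₁, hab₁, hs₁⟩ | ⟨rfl, hx₁, hK₁⟩ <;>
  rcases h₂ with ⟨a₂, b₂, rfl, rfl, ha₂, hK₂, hb₂, hab₂, hs₂⟩ | ⟨rfl, hx₂, hK₂⟩
  · have e1 : (M - a₁ - (M - a₂)) * (-b₁ - -b₂) = -(a₁ * b₂) - a₂ * b₁ := by
      linear_combination hab₁ + hab₂
    have p1 := mul_nonneg ha₁ hb₂
    have p2 := mul_nonneg ha₂ hb₁
    rw [e1]
    refine ⟨by linarith, fun h => ?_⟩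
    have q1 : a₁ * b₂ = 0 := by linarith
    have q2 : a₂ * b₁ = 0 := by linarith
    simp only [neg_eq_zero]
    constructor
    · rintro rfl
      exact (mul_eq_zero.1 q1).resolve_left (by linarith)
    · rintro rfl
      exact (mul_eq_zero.1 q2).resolve_left (by linarith)
  · have p : 0 < M - a₁ - ξ₂ := by linarith
    rw [sub_zero]
    refine ⟨by nlinarith, fun h => ?_⟩
    simpa using (mul_eq_zero.1 h).resolve_left p.ne'
  · have p : 0 < M - a₂ - ξ₁ := by linarith
    refine ⟨by nlinarith, fun h => ?_⟩
    have h' : (M - a₂ - ξ₁) * b₂ = 0 := by linarith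
    have := (mul_eq_zero.1 h').resolve_left p.ne'
    simp [this]
  · simp

/-- At an edge of the image the perturbed solutions are as described by `InImage`. -/
theorem inImage (C : PhiCertificate Z B w w' O S) {M K : ℝ}
    (hx : ∀ e, |C.x e| ≤ K) {e : E} (he : e ∈ S) :
    InImage M K (O.sign e * (C.x e - M * C.z e)) (O.sign e * (C.y e - M * C.b e)) ∧
      ((O.sign e * (C.y e - M * C.b e) : ℝ) = 0 ↔ e ∈ C.T) := by
  have hS := he
  rw [C.S_eq] at hS
  obtain ⟨hTA, hD⟩ := hS
  have hb := C.b_off e hD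
  have hxe := abs_le.1 (hx e)
  -- On a reversed cycle edge the sign flips, so `-M z` contributes `+M`; complementarity of `x` and
  -- `y` gives `a = |x e|, b = 0` on the tree and `a = 0, b = |y e|` off it. An unreversed edge of
  -- the image is a tree edge and falls in the second case of `InImage`.
  by_cases hA : e ∈ C.A
  · have hs : O.sign e = -C.base.sign e := by
      conv_lhs => rw [C.orient]
      exact C.base.sign_reverse_mem (Or.inl hA)
    rw [hb, C.z_on e hA, hs]
    have hss := C.base.sign_mul_self e
    push_cast
    by_cases hT : e ∈ C.T
    · have hxp := C.x_pos e hT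
      rw [C.y_zero e hT]
      refine ⟨Or.inl ⟨C.base.sign e * C.x e, 0, ?_, by ring, hxp.le, ?_, le_rfl, by ring,
        by linarith⟩, by simp [hT]⟩
      · linear_combination M * hss
      · rcases C.base.sign_eq_or e with h | h <;> rw [h] <;> push_cast <;> linarith
    · have hyp := C.y_pos e hT
      rw [C.x_zero e hT] at hxe ⊢
      refine ⟨Or.inl ⟨0, C.base.sign e * C.y e, ?_, by ring, le_rfl, hxe.2, hyp.le, by ring,
        by linarith⟩, ?_⟩
      · linear_combination M * hss
      · simp only [hT, iff_false]
        intro h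
        linarith
  · have hT : e ∈ C.T := hTA.resolve_right hA
    have hs : O.sign e = C.base.sign e := by
      conv_lhs => rw [C.orient]
      exact C.base.sign_reverse_notMem (by simp [hA, hD])
    rw [hb, C.z_off e hA, hs, C.y_zero e hT]
    have hxp := C.x_pos e hT
    refine ⟨Or.inr ⟨by ring, by linarith, ?_⟩, by simp [hT]⟩
    rcases C.base.sign_eq_or e with h | h <;> rw [h] <;> push_cast <;> linarith

/-- The certificate of the dual problem. -/
def dual (C : PhiCertificate Z B w w' O S) : PhiCertificate B Z w' w O Sᶜ where
  base := C.base
  T := C.Tᶜ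
  A := C.D
  D := C.A
  x := C.y
  y := C.x
  z := C.b
  b := C.z
  x_mem := C.y_mem
  y_mem := C.x_mem
  z_mem := C.b_mem
  b_mem := C.z_mem
  disj := fun e he hA => C.disj e hA he
  x_pos := C.y_pos
  x_zero := fun e he => C.y_zero e (not_not.1 he)
  y_pos := fun e he => C.x_pos e (not_not.1 he)
  y_zero := C.x_zero
  z_on := C.b_on
  z_off := C.b_off
  b_on := C.z_on
  b_off := C.z_off
  orient := by rw [Set.union_comm]; exact C.orient
  S_eq := by
    ext e
    have h1 := C.disj e
    have h2 : e ∈ S ↔ e ∈ (C.T ∪ C.A) \ C.D := by rw [← C.S_eq]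
    rw [Set.mem_compl_iff, h2]
    simp only [Set.mem_compl_iff, Set.mem_sdiff, Set.mem_union]
    tauto
  tree_indep := fun b hb h => C.tree_span b hb fun e he => h e (not_not.2 he)
  tree_span := C.tree_indep

variable [Fintype E]

theorem exists_abs_le (f : E → ℝ) : ∃ K, 0 ≤ K ∧ ∀ e, |f e| ≤ K :=
  ⟨∑ e, |f e|, Finset.sum_nonneg fun _ _ => abs_nonneg _, fun e =>
    Finset.single_le_sum (f := fun e => |f e|) (fun _ _ => abs_nonneg _) (Finset.mem_univ e)⟩

/-- Two orientations with different certificates differ at an edge that is in exactly one of the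
two images. -/
theorem eq_of_agree (hZB : ∀ z ∈ Z, ∀ b ∈ B, z ⬝ᵥ b = 0)
    (C₁ : PhiCertificate Z B w w' O₁ S₁) (C₂ : PhiCertificate Z B w w' O₂ S₂)
    (h : ∀ e, O₁ e ≠ O₂ e → (e ∈ S₁ ↔ e ∈ S₂)) : O₁ = O₂ ∧ S₁ = S₂ := by
  obtain ⟨k₁, hk₁, hx₁⟩ := exists_abs_le C₁.x
  obtain ⟨k₂, hk₂, hx₂⟩ := exists_abs_le C₂.x
  obtain ⟨k₃, hk₃, hy₁⟩ := exists_abs_le C₁.y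
  obtain ⟨k₄, hk₄, hy₂⟩ := exists_abs_le C₂.y
  set K := k₁ + k₂ + k₃ + k₄ with hK
  have hK0 : 0 ≤ K := by linarith
  set M := 2 * K + 1 with hM
  have hMK : 2 * K < M := by linarith
  replace hx₁ : ∀ e, |C₁.x e| ≤ K := fun e => (hx₁ e).trans (by linarith)
  replace hx₂ : ∀ e, |C₂.x e| ≤ K := fun e => (hx₂ e).trans (by linarith)
  replace hy₁ : ∀ e, |C₁.y e| ≤ K := fun e => (hy₁ e).trans (by linarith)
  replace hy₂ : ∀ e, |C₂.y e| ≤ K := fun e => (hy₂ e).trans (by linarith)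
  set X₁ : E → ℝ := C₁.x - M • C₁.z with hX₁
  set X₂ : E → ℝ := C₂.x - M • C₂.z with hX₂
  set Y₁ : E → ℝ := C₁.y - M • C₁.b with hY₁
  set Y₂ : E → ℝ := C₂.y - M • C₂.b with hY₂
  -- The offsets `w'` and `w` cancel, leaving a vector of `Z` paired with a vector of `B`.
  have hsum : ∑ e, (X₁ e - X₂ e) * (Y₁ e - Y₂ e) = 0 := by
    refine hZB (X₁ - X₂) ?_ (Y₁ - Y₂) ?_
    · have : X₁ - X₂ = (C₁.x - w') - (C₂.x - w') - (M • C₁.z - M • C₂.z) := by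
        rw [hX₁, hX₂]; abel
      rw [this]
      exact Z.sub_mem (Z.sub_mem C₁.x_mem C₂.x_mem)
        (Z.sub_mem (Z.smul_mem _ C₁.z_mem) (Z.smul_mem _ C₂.z_mem))
    · have : Y₁ - Y₂ = (C₁.y - w) - (C₂.y - w) - (M • C₁.b - M • C₂.b) := by
        rw [hY₁, hY₂]; abel
      rw [this]
      exact B.sub_mem (B.sub_mem C₁.y_mem C₂.y_mem)
        (B.sub_mem (B.smul_mem _ C₁.b_mem) (B.smul_mem _ C₂.b_mem))
  have key : ∀ e, (X₁ e - X₂ e) * (Y₁ e - Y₂ e) ≤ 0 ∧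
      ((X₁ e - X₂ e) * (Y₁ e - Y₂ e) = 0 → (e ∈ C₁.T ↔ e ∈ C₂.T) ∧ (e ∈ S₁ ↔ e ∈ S₂)) := by
    intro e
    have i₁ : e ∈ S₁ → InImage M K (O₁.sign e * X₁ e) (O₁.sign e * Y₁ e) ∧
      ((O₁.sign e * Y₁ e : ℝ) = 0 ↔ e ∈ C₁.T) := fun he => C₁.inImage hx₁ he
    have i₂ : e ∈ S₂ → InImage M K (O₂.sign e * X₂ e) (O₂.sign e * Y₂ e) ∧
      ((O₂.sign e * Y₂ e : ℝ) = 0 ↔ e ∈ C₂.T) := fun he => C₂.inImage hx₂ he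
    have j₁ : e ∉ S₁ → InImage M K (O₁.sign e * Y₁ e) (O₁.sign e * X₁ e) ∧
      ((O₁.sign e * X₁ e : ℝ) = 0 ↔ e ∉ C₁.T) := fun he => C₁.dual.inImage hy₁ he
    have j₂ : e ∉ S₂ → InImage M K (O₂.sign e * Y₂ e) (O₂.sign e * X₂ e) ∧
      ((O₂.sign e * X₂ e : ℝ) = 0 ↔ e ∉ C₂.T) := fun he => C₂.dual.inImage hy₂ he
    have hss := O₁.sign_mul_self e
    -- In the direction of the orientation, `X` is positive and `Y` nonpositive on the image, and
    -- vice versa off it. So for equal directions, membership in exactly one image makes the product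
    -- strictly negative; equal membership is the L-curve comparison.
    by_cases heq : O₁ e = O₂ e
    · have hs : O₁.sign e = O₂.sign e := (O₁.sign_eq_iff O₂ e).2 heq
      rw [← hs] at i₂ j₂
      have hprod : (X₁ e - X₂ e) * (Y₁ e - Y₂ e) =
          (O₁.sign e * X₁ e - O₁.sign e * X₂ e) * (O₁.sign e * Y₁ e - O₁.sign e * Y₂ e) := by
        linear_combination (-(X₁ e - X₂ e) * (Y₁ e - Y₂ e)) * hss
      rw [hprod]
      by_cases h₁ : e ∈ S₁ <;> by_cases h₂ : e ∈ S₂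
      · obtain ⟨p₁, q₁⟩ := i₁ h₁
        obtain ⟨p₂, q₂⟩ := i₂ h₂
        have := p₁.mul_sub_sub hMK p₂
        rw [q₁, q₂] at this
        exact ⟨this.1, fun h0 => ⟨this.2 h0, by simp [h₁, h₂]⟩⟩
      · obtain ⟨p₁, q₁⟩ := (i₁ h₁).1.signs hMK hK0
        obtain ⟨p₂, q₂⟩ := (j₂ h₂).1.signs hMK hK0
        have : (O₁.sign e * X₁ e - O₁.sign e * X₂ e) * (O₁.sign e * Y₁ e - O₁.sign e * Y₂ e)
          < (0 : ℝ) := mul_neg_of_pos_of_neg (by linarith) (by linarith)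
        exact ⟨this.le, fun h0 => absurd h0 this.ne⟩
      · obtain ⟨p₁, q₁⟩ := (j₁ h₁).1.signs hMK hK0
        obtain ⟨p₂, q₂⟩ := (i₂ h₂).1.signs hMK hK0
        have : (O₁.sign e * X₁ e - O₁.sign e * X₂ e) * (O₁.sign e * Y₁ e - O₁.sign e * Y₂ e)
          < (0 : ℝ) := mul_neg_of_neg_of_pos (by linarith) (by linarith)
        exact ⟨this.le, fun h0 => absurd h0 this.ne⟩
      · obtain ⟨p₁, q₁⟩ := j₁ h₁
        obtain ⟨p₂, q₂⟩ := j₂ h₂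
        have := p₁.mul_sub_sub hMK p₂
        rw [q₁, q₂, mul_comm, not_iff_not] at this
        exact ⟨this.1, fun h0 => ⟨this.2 h0, by simp [h₁, h₂]⟩⟩
    -- For opposite directions the differences become sums of terms of one sign. The product can
    -- vanish only if both `Y` terms do (in the images), so `e` lies in both trees, or both `X`
    -- terms do (off the images), so `e` lies in neither.
    · have hS := h e heq
      have hs : (O₂.sign e : ℝ) = -O₁.sign e := by
        have : O₁.sign e ≠ O₂.sign e := fun h0 => heq ((O₁.sign_eq_iff O₂ e).1 h0)
        rcases O₁.sign_eq_or e with h1 | h1 <;> rcases O₂.sign_eq_or e with h2 | h2 <;>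
          simp_all
      rw [hs] at i₂ j₂
      by_cases h₁ : e ∈ S₁
      · have h₂ := hS.1 h₁
        obtain ⟨p₁, q₁⟩ := i₁ h₁
        obtain ⟨p₂, q₂⟩ := i₂ h₂
        obtain ⟨r₁, s₁⟩ := p₁.signs hMK hK0
        obtain ⟨r₂, s₂⟩ := p₂.signs hMK hK0
        have hprod : (X₁ e - X₂ e) * (Y₁ e - Y₂ e) =
          (O₁.sign e * X₁ e + -O₁.sign e * X₂ e) * (O₁.sign e * Y₁ e + -O₁.sign e * Y₂ e) := by
          linear_combination (-(X₁ e - X₂ e) * (Y₁ e - Y₂ e)) * hss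
        rw [hprod]
        refine ⟨mul_nonpos_of_nonneg_of_nonpos (by linarith) (by linarith), fun h0 => ?_⟩
        have h3 := (mul_eq_zero.1 h0).resolve_left (by linarith)
        have t₁ := q₁.1 (by linarith)
        have t₂ := q₂.1 (by linarith)
        simp [h₁, h₂, t₁, t₂]
      · have h₂ : e ∉ S₂ := fun h0 => h₁ (hS.2 h0)
        obtain ⟨p₁, q₁⟩ := j₁ h₁
        obtain ⟨p₂, q₂⟩ := j₂ h₂
        obtain ⟨r₁, s₁⟩ := p₁.signs hMK hK0
        obtain ⟨r₂, s₂⟩ := p₂.signs hMK hK0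
        have hprod : (X₁ e - X₂ e) * (Y₁ e - Y₂ e) =
          (O₁.sign e * X₁ e + -O₁.sign e * X₂ e) * (O₁.sign e * Y₁ e + -O₁.sign e * Y₂ e) := by
          linear_combination (-(X₁ e - X₂ e) * (Y₁ e - Y₂ e)) * hss
        rw [hprod]
        refine ⟨mul_nonpos_of_nonpos_of_nonneg (by linarith) (by linarith), fun h0 => ?_⟩
        have h3 := (mul_eq_zero.1 h0).resolve_right (by linarith)
        have t₁ := q₁.1 (by linarith)
        have t₂ := q₂.1 (by linarith)
        simp [h₁, h₂, t₁, t₂]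
  have hzero : ∀ e, (X₁ e - X₂ e) * (Y₁ e - Y₂ e) = 0 := fun e =>
    (Finset.sum_eq_zero_iff_of_nonpos (fun e _ => (key e).1)).1 hsum e (Finset.mem_univ e)
  have hT : C₁.T = C₂.T := Set.ext fun e => ((key e).2 (hzero e)).1
  have hS : S₁ = S₂ := Set.ext fun e => ((key e).2 (hzero e)).2
  -- The tree determines `x` and `y`: a vector of `Z` supported on `T`, or of `B` vanishing on `T`,
  -- is zero.
  have hx : C₁.x = C₂.x := sub_eq_zero.1 <| C₁.tree_indep _
    (by simpa using Z.sub_mem C₁.x_mem C₂.x_mem) fun e he => by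
      simp [C₁.x_zero e he, C₂.x_zero e (hT ▸ he)]
  have hy : C₁.y = C₂.y := sub_eq_zero.1 <| C₁.tree_span _
    (by simpa using B.sub_mem C₁.y_mem C₂.y_mem) fun e he => by
      simp [C₁.y_zero e he, C₂.y_zero e (hT ▸ he)]
  have hbase : ∀ e, C₁.base.sign e = C₂.base.sign e := by
    intro e
    have aux : ∀ r : ℝ, 0 < C₁.base.sign e * r → 0 < C₂.base.sign e * r →
        C₁.base.sign e = C₂.base.sign e := by
      intro r h3 h4
      rcases C₁.base.sign_eq_or e with h1 | h1 <;> rcases C₂.base.sign_eq_or e with h2 | h2 <;>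
        rw [h1] at h3 ⊢ <;> rw [h2] at h4 ⊢ <;> push_cast at h3 h4 <;> linarith
    by_cases he : e ∈ C₁.T
    · exact aux _ (C₁.x_pos e he) (hx ▸ C₂.x_pos e (hT ▸ he))
    · exact aux _ (C₁.y_pos e he) (hy ▸ C₂.y_pos e (hT ▸ he))
  -- Off the tree, belonging to `S` means belonging to `A`; so `z₁ - z₂` is supported on `T`.
  -- Likewise, on the tree `S` determines `D`, whence `b₁ = b₂`.
  have hz : C₁.z = C₂.z := by
    refine sub_eq_zero.1 <| C₁.tree_indep _ (Z.sub_mem C₁.z_mem C₂.z_mem) fun e he => ?_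
    have he' : e ∉ C₂.T := hT ▸ he
    have hmem : e ∈ (C₁.T ∪ C₁.A) \ C₁.D ↔ e ∈ (C₂.T ∪ C₂.A) \ C₂.D := by
      rw [← C₁.S_eq, ← C₂.S_eq, hS]
    simp only [Set.mem_sdiff, Set.mem_union, he, he', false_or] at hmem
    rw [Pi.sub_apply]
    by_cases h₁ : e ∈ C₁.A
    · have h₂ := (hmem.1 ⟨h₁, C₁.disj e h₁⟩).1
      rw [C₁.z_on e h₁, C₂.z_on e h₂, hbase e, sub_self]
    · have h₂ : e ∉ C₂.A := fun h2 => h₁ (hmem.2 ⟨h2, C₂.disj e h2⟩).1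
      rw [C₁.z_off e h₁, C₂.z_off e h₂, sub_self]
  have hb : C₁.b = C₂.b := by
    refine sub_eq_zero.1 <| C₁.tree_span _ (B.sub_mem C₁.b_mem C₂.b_mem) fun e he => ?_
    have he' : e ∈ C₂.T := hT ▸ he
    have hmem : e ∈ (C₁.T ∪ C₁.A) \ C₁.D ↔ e ∈ (C₂.T ∪ C₂.A) \ C₂.D := by
      rw [← C₁.S_eq, ← C₂.S_eq, hS]
    simp only [Set.mem_sdiff, Set.mem_union, he, he', true_or, true_and, not_iff_not] at hmem
    rw [Pi.sub_apply]
    by_cases h₁ : e ∈ C₁.D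
    · rw [C₁.b_on e h₁, C₂.b_on e (hmem.1 h₁), hbase e, sub_self]
    · rw [C₁.b_off e h₁, C₂.b_off e (fun h2 => h₁ (hmem.2 h2)), sub_self]
  refine ⟨?_, hS⟩
  have hne : ∀ (Q : DiscreteOrientation E) e, (Q.sign e : ℝ) ≠ 0 := fun Q e h0 => by
    have := Q.sign_mul_self e
    rw [h0] at this; simp at this
  have hAmem : ∀ (e : E), e ∈ C₁.A ↔ e ∈ C₂.A := fun e => by
    constructor
    · intro h1
      by_contra h2
      exact hne _ e ((C₁.z_on e h1).symm.trans (by rw [hz, C₂.z_off e h2]))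
    · intro h1
      by_contra h2
      exact hne _ e ((C₂.z_on e h1).symm.trans (by rw [← hz, C₁.z_off e h2]))
  have hDmem : ∀ (e : E), e ∈ C₁.D ↔ e ∈ C₂.D := fun e => by
    constructor
    · intro h1
      by_contra h2
      exact hne _ e ((C₁.b_on e h1).symm.trans (by rw [hb, C₂.b_off e h2]))
    · intro h1
      by_contra h2
      exact hne _ e ((C₂.b_on e h1).symm.trans (by rw [← hb, C₁.b_off e h2]))
  rw [C₁.orient, C₂.orient, Set.ext hAmem, Set.ext hDmem]
  congr 1
  funext e
  exact (C₁.base.sign_eq_iff C₂.base e).1 (hbase e)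

end PhiCertificate

end Certificate

/-! ### The cut space and its elementary vectors, the directed cocycles -/

namespace RefGraph

variable {V E : Type*} (G : RefGraph V E)

/-- The potential differences of `p` along the edges. -/
def coboundary : (V → ℝ) →ₗ[ℝ] (E → ℝ) where
  toFun p e := p (G.tail e) - p (G.head e)
  map_add' p q := by funext e; simp only [Pi.add_apply]; ring
  map_smul' r p := by
    funext e; simp only [Pi.smul_apply, smul_eq_mul, RingHom.id_apply]; ring

theorem coboundary_apply (p : V → ℝ) (e : E) :
    G.coboundary p e = p (G.tail e) - p (G.head e) := rfl

/-- The cut space: the potential differences. -/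
def cutSpace : Submodule ℝ (E → ℝ) := LinearMap.range G.coboundary

theorem toVec_directedCut (W : Set V) :
    toVec (G.directedCut W) = G.coboundary (W.indicator 1) := by
  classical
  funext e
  rw [toVec_apply, coboundary_apply, directedCut]
  by_cases h1 : G.tail e ∈ W <;> by_cases h2 : G.head e ∈ W <;> simp [h1, h2]

theorem directedCut_ne_zero_iff (W : Set V) (e : E) : G.directedCut W e ≠ 0 ↔ e ∈ G.cut W := by
  classical
  simp only [directedCut, cut, Set.mem_ofPred_eq]
  by_cases h1 : G.tail e ∈ W <;> by_cases h2 : G.head e ∈ W <;> simp [h1, h2]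

theorem support_directedCut (W : Set V) : Function.support (G.directedCut W) = G.cut W :=
  Set.ext fun e => G.directedCut_ne_zero_iff W e

theorem directedCut_values (W : Set V) (e : E) :
    G.directedCut W e = 0 ∨ G.directedCut W e = 1 ∨ G.directedCut W e = -1 := by
  unfold directedCut; split_ifs <;> simp

theorem directedCut_compl (W : Set V) : G.directedCut Wᶜ = -G.directedCut W := by
  classical
  funext e
  simp only [directedCut, Pi.neg_apply, Set.mem_compl_iff]
  by_cases h1 : G.tail e ∈ W <;> by_cases h2 : G.head e ∈ W <;> simp [h1, h2]

theorem cut_compl (W : Set V) : G.cut Wᶜ = G.cut W := by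
  rw [← support_directedCut, directedCut_compl, Function.support_neg, support_directedCut]

/-- Crossing the two cuts in opposite directions would need one endpoint in `X \ W` and the other in
`W \ X`, one of which is empty. -/
theorem directedCut_eq_of_nested {X W : Set V} (h : X ⊆ W ∨ W ⊆ X) {e : E}
    (hX : e ∈ G.cut X) (hW : e ∈ G.cut W) : G.directedCut X e = G.directedCut W e := by
  simp only [directedCut]
  rcases h with h | h <;> rcases hX with ⟨h1, h2⟩ | ⟨h1, h2⟩ <;>
    rcases hW with ⟨h3, h4⟩ | ⟨h3, h4⟩ <;>
    first
    | (simp [h1, h2, h3, h4]; done)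
    | exact absurd (h h1) h3
    | exact absurd (h h2) h4
    | exact absurd (h h3) h1
    | exact absurd (h h4) h2

theorem mem_cut_of_mem_inter_or_union {W U : Set V} {e : E} (h : e ∈ G.cut U → e ∈ G.cut W)
    (he : e ∈ G.cut (W ∩ U) ∨ e ∈ G.cut (W ∪ U)) : e ∈ G.cut W := by
  simp only [cut, Set.mem_ofPred_eq, Set.mem_inter_iff, Set.mem_union] at h he ⊢
  by_cases a : G.tail e ∈ U <;> by_cases b : G.head e ∈ U <;>
    by_cases c : G.tail e ∈ W <;> by_cases d : G.head e ∈ W <;> simp [a, b, c, d] at h he ⊢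

/-- If two edges of the cut of `W` belong to the same ones among the cuts of `W ∩ U` and `W ∪ U`,
and one of them is in the cut of `U`, then so is the other one. -/
theorem mem_cut_of_inter_union {W U : Set V} {e f : E} (he : e ∈ G.cut W) (hfW : f ∈ G.cut W)
    (hf : f ∈ G.cut U) (h1 : e ∈ G.cut (W ∩ U) ↔ f ∈ G.cut (W ∩ U))
    (h2 : e ∈ G.cut (W ∪ U) ↔ f ∈ G.cut (W ∪ U)) : e ∈ G.cut U := by
  simp only [cut, Set.mem_ofPred_eq, Set.mem_inter_iff, Set.mem_union] at h1 h2 hf hfW he ⊢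
  by_cases a : G.tail e ∈ U <;> by_cases b : G.head e ∈ U <;>
    rcases he with ⟨e1, e2⟩ | ⟨e1, e2⟩ <;> rcases hfW with ⟨f1, f2⟩ | ⟨f1, f2⟩ <;>
    rcases hf with ⟨f3, f4⟩ | ⟨f3, f4⟩ <;>
    simp [a, b, e1, e2, f1, f2, f3, f4] at h1 h2 ⊢

/-- A nonempty cut of minimal size among those conforming to a vector is a cocycle. -/
theorem exists_directedCocycle_conformal [Finite V] [Finite E] {b : E → ℝ} (hb : b ∈ G.cutSpace)
    (hne : b ≠ 0) : ∃ d, G.IsDirectedCocycle d ∧ ∀ e, d e ≠ 0 → 0 < (d e : ℝ) * b e := by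
  classical
  obtain ⟨p, rfl⟩ := hb
  let Q : Set (Set V) := {W | (G.cut W).Nonempty ∧
    ∀ e, G.directedCut W e ≠ 0 → 0 < (G.directedCut W e : ℝ) * G.coboundary p e}
  have hQ : Q.Nonempty := by
    obtain ⟨e, he⟩ : ∃ e, G.coboundary p e ≠ 0 := by
      by_contra! h
      exact hne (funext h)
    rw [coboundary_apply] at he
    -- Every edge crossing a superlevel set of `p` descends outwards, so its cut conforms; this
    -- threshold makes `e` cross.
    refine ⟨{v | max (p (G.tail e)) (p (G.head e)) ≤ p v}, ⟨e, ?_⟩, ?_⟩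
    · simp only [cut, Set.mem_ofPred_eq, max_le_iff, le_refl, true_and, and_true, not_le]
      rcases lt_or_gt_of_ne (sub_ne_zero.1 he) with h | h
      · exact Or.inr ⟨h, h.le⟩
      · exact Or.inl ⟨h.le, h⟩
    · intro f hf
      rw [coboundary_apply]
      set m := max (p (G.tail e)) (p (G.head e))
      by_cases h1 : m ≤ p (G.tail f) <;> by_cases h2 : m ≤ p (G.head f) <;>
        simp only [directedCut, Set.mem_ofPred_eq, h1, h2, not_true_eq_false, not_false_eq_true,
          and_true, and_false, if_true, if_false, ne_eq] at hf ⊢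
      · push_cast; linarith
      · push_cast; linarith
  obtain ⟨W, hW, hmin⟩ := Set.exists_min_image Q (fun W => (G.cut W).ncard) (Set.toFinite _) hQ
  refine ⟨G.directedCut W, ⟨W, ⟨⟨hW.1, W, rfl⟩, ?_⟩, rfl⟩, hW.2⟩
  rintro _ ⟨⟨f, hf⟩, U, rfl⟩ hUW
  -- A nested `X` whose cut is inside that of `W` inherits conformity, so by minimality its cut is
  -- empty or all of `G.cut W`. Applied to `W ∩ U` and `W ∪ U`, this makes `G.cut U` all of `G.cut
  -- W`.
  have part : ∀ X : Set V, (X ⊆ W ∨ W ⊆ X) → (∀ e, e ∈ G.cut X → e ∈ G.cut W) →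
      ∀ e e', e ∈ G.cut W → e' ∈ G.cut X → e ∈ G.cut X := by
    intro X hXW hsub e e' heW hX
    have hXQ : X ∈ Q := by
      refine ⟨⟨e', hX⟩, fun e he => ?_⟩
      have he' := hsub e ((G.directedCut_ne_zero_iff X e).1 he)
      have heq := G.directedCut_eq_of_nested hXW ((G.directedCut_ne_zero_iff X e).1 he) he'
      rw [heq]
      exact hW.2 e ((G.directedCut_ne_zero_iff W e).2 he')
    have h1 : G.cut X = G.cut W := Set.eq_of_subset_of_ncard_le hsub (hmin X hXQ)
    rw [h1]; exact heW
  have hsub : ∀ e, e ∈ G.cut U → e ∈ G.cut W := fun e he => hUW he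
  have hfW := hsub f hf
  intro e he
  have piece : ∀ X : Set V, (X ⊆ W ∨ W ⊆ X) → (∀ e, e ∈ G.cut X → e ∈ G.cut W) →
      (e ∈ G.cut X ↔ f ∈ G.cut X) := fun X h1 h2 =>
    ⟨fun h => part X h1 h2 f e hfW h, fun h => part X h1 h2 e f he h⟩
  exact G.mem_cut_of_inter_union he hfW hf
    (piece (W ∩ U) (Or.inl Set.inter_subset_left) fun e he =>
      G.mem_cut_of_mem_inter_or_union (hsub e) (Or.inl he))
    (piece (W ∪ U) (Or.inr Set.subset_union_left) fun e he =>
      G.mem_cut_of_mem_inter_or_union (hsub e) (Or.inr he))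

theorem cut_mem_minimal {d d' : E → ℤ} [Finite V] [Finite E] (hd : G.IsDirectedCocycle d)
    (hd' : G.IsDirectedCocycle d') (h : ∀ e, d' e ≠ 0 → d e ≠ 0) (e : E) (he : d e ≠ 0) :
    d' e ≠ 0 := by
  obtain ⟨W, hW, rfl⟩ := hd
  obtain ⟨W', hW', rfl⟩ := hd'
  rw [directedCut_ne_zero_iff] at he ⊢
  exact hW.2 hW'.1 (fun f hf => (G.directedCut_ne_zero_iff W f).1
    (h f ((G.directedCut_ne_zero_iff W' f).2 hf))) he

/-- The directed cocycles are elementary vectors of the cut space. -/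
theorem isElementarySystem_cocycle [Finite V] [Finite E] :
    IsElementarySystem G.IsDirectedCocycle G.cutSpace where
  mem := by
    rintro _ ⟨W, _, rfl⟩
    rw [toVec_directedCut]
    exact ⟨_, rfl⟩
  values := by
    rintro _ ⟨W, _, rfl⟩
    exact G.directedCut_values W
  neg := by
    rintro _ ⟨W, hW, rfl⟩
    exact ⟨Wᶜ, by rwa [cut_compl], G.directedCut_compl W⟩
  nonzero := by
    rintro _ ⟨W, hW, rfl⟩
    obtain ⟨e, he⟩ := hW.1.1
    exact ⟨e, (G.directedCut_ne_zero_iff W e).2 he⟩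
  conformal := fun b hb hne => G.exists_directedCocycle_conformal hb hne
  eq_or_neg := by
    intro d d' hd hd' hsupp
    have mem : ∀ d, G.IsDirectedCocycle d → toVec d ∈ G.cutSpace := by
      rintro _ ⟨W, _, rfl⟩
      rw [toVec_directedCut]
      exact ⟨_, rfl⟩
    have hs : ∀ e, d e ≠ 0 ↔ d' e ≠ 0 := fun e => by
      rw [← Function.mem_support, ← Function.mem_support, hsupp]
    -- If the difference were nonzero, a cocycle conforming to it would lie in the support of `d`
    -- and miss `e`, against minimality.
    have aux : ∀ s : ℝ, (∃ e, d e ≠ 0 ∧ (toVec d - s • toVec d') e = 0) →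
        toVec d - s • toVec d' = 0 := by
      rintro s ⟨e, he, he0⟩
      by_contra hne
      obtain ⟨c, hc, hcs⟩ := G.exists_directedCocycle_conformal
        (G.cutSpace.sub_mem (mem d hd) (G.cutSpace.smul_mem s (mem d' hd'))) hne
      have h1 := G.cut_mem_minimal hd hc (fun f hf h0 => by
        have h1 := hcs f hf
        have h2 : d' f = 0 := by
          by_contra h2
          exact (hs f).2 h2 h0
        simp [h0, h2] at h1) e he
      have h2 := hcs e h1
      rw [he0, mul_zero] at h2
      exact lt_irrefl _ h2
    obtain ⟨e, he⟩ : ∃ e, d e ≠ 0 := by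
      obtain ⟨W, hW, rfl⟩ := hd
      obtain ⟨e, he⟩ := hW.1.1
      exact ⟨e, (G.directedCut_ne_zero_iff W e).2 he⟩
    have val : ∀ d, G.IsDirectedCocycle d → d e ≠ 0 → d e = 1 ∨ d e = -1 := by
      rintro _ ⟨W, _, rfl⟩ h0
      exact (G.directedCut_values W e).resolve_left h0
    have hval : d e = d' e ∨ d e = -d' e := by
      rcases val d hd he with h1 | h1 <;> rcases val d' hd' ((hs e).1 he) with h2 | h2 <;>
        simp [h1, h2]
    rcases hval with h | h
    · left
      have := aux 1 ⟨e, he, by simp [h]⟩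
      funext f
      have := congrFun this f
      simp only [one_smul, Pi.sub_apply, toVec_apply, Pi.zero_apply, sub_eq_zero] at this
      exact_mod_cast this
    · right
      have := aux (-1) ⟨e, he, by simp [h]⟩
      funext f
      have := congrFun this f
      simp only [neg_smul, one_smul, Pi.sub_apply, Pi.neg_apply, toVec_apply, Pi.zero_apply,
        sub_eq_zero] at this
      rw [Pi.neg_apply]
      exact_mod_cast this

end RefGraph

/-! ### The cycle space and its elementary vectors, the directed cycles -/

namespace RefGraph

variable {V E : Type*} (G : RefGraph V E)

theorem IsArc.sign_eq {G : RefGraph V E} {e : E} {s : ℤ} {u v : V} (h : G.IsArc e s u v) :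
    s = 1 ∨ s = -1 := h.imp And.left And.left

theorem IsArc.coboundary {G : RefGraph V E} {e : E} {s : ℤ} {u v : V} (h : G.IsArc e s u v)
    (p : V → ℝ) : G.coboundary p e = s * (p u - p v) := by
  rw [coboundary_apply]
  rcases h with ⟨rfl, rfl, rfl⟩ | ⟨rfl, rfl, rfl⟩ <;> push_cast <;> ring

/-- The reversal of a directed cycle is a directed cycle. -/
theorem IsDirectedCycle.neg {G : RefGraph V E} {c : E → ℤ} (hc : G.IsDirectedCycle c) :
    G.IsDirectedCycle (-c) := by
  obtain ⟨n, v, e, hv, he, harc, hsupp⟩ := hc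
  -- The reversed walk leaves `v (-i)` for `v (-i - 1)` along the edge that used to enter `v (-i)`,
  -- hence the shift in the edge index.
  refine ⟨n, fun i => v (-i), fun i => e (-(i + 1)), hv.comp neg_injective,
    he.comp (neg_injective.comp (add_left_injective 1)), fun i => ?_, ?_⟩
  · have h := harc (-(i + 1))
    have h1 : -(i + 1) + 1 = -i := by abel
    rw [h1] at h
    rcases h with ⟨h1, h2, h3⟩ | ⟨h1, h2, h3⟩
    · exact Or.inr ⟨congrArg Neg.neg h1, h3, h2⟩
    · exact Or.inl ⟨by rw [Pi.neg_apply, h1, neg_neg], h3, h2⟩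
  · rw [Function.support_neg, hsupp]
    ext f
    constructor
    · rintro ⟨i, rfl⟩
      exact ⟨-i - 1, by simp⟩
    · rintro ⟨i, rfl⟩
      exact ⟨_, rfl⟩

theorem IsDirectedCycle.values {G : RefGraph V E} {c : E → ℤ} (hc : G.IsDirectedCycle c) (e : E) :
    c e = 0 ∨ c e = 1 ∨ c e = -1 := by
  obtain ⟨n, v, e', hv, he, harc, hsupp⟩ := hc
  by_cases h : e ∈ Set.range e'
  · obtain ⟨i, rfl⟩ := h
    exact Or.inr (harc i).sign_eq
  · rw [← hsupp] at h
    exact Or.inl (by simpa using h)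

variable [Fintype E]

/-- The cycle space: the flows that are orthogonal to all potential differences. -/
def cycleSpace : Submodule ℝ (E → ℝ) where
  carrier := {z | ∀ p, z ⬝ᵥ G.coboundary p = 0}
  add_mem' h h' p := by rw [add_dotProduct, h p, h' p, add_zero]
  zero_mem' p := zero_dotProduct _
  smul_mem' r z h p := by rw [smul_dotProduct, h p, smul_zero]

theorem mem_cycleSpace {z : E → ℝ} : z ∈ G.cycleSpace ↔ ∀ p, z ⬝ᵥ G.coboundary p = 0 := Iff.rfl

theorem dotProduct_eq_zero {z b : E → ℝ} (hz : z ∈ G.cycleSpace) (hb : b ∈ G.cutSpace) :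
    z ⬝ᵥ b = 0 := by
  obtain ⟨p, rfl⟩ := hb
  exact hz p

/-- The pairing of a vector on the edges of a closed walk with a potential difference. -/
theorem dotProduct_coboundary_of_cycle {n : ℕ} {v : Fin (n + 1) → V} {e : Fin (n + 1) → E}
    {c : E → ℤ} (he : Function.Injective e)
    (harc : ∀ i, G.IsArc (e i) (c (e i)) (v i) (v (i + 1))) {z : E → ℝ}
    (hz : ∀ f, f ∉ Set.range e → z f = 0) (p : V → ℝ) :
    z ⬝ᵥ G.coboundary p = ∑ i, z (e i) * c (e i) * (p (v i) - p (v (i + 1))) := by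
  classical
  have h1 : ∑ i, z (e i) * c (e i) * (p (v i) - p (v (i + 1))) =
      ∑ f ∈ Finset.univ.map ⟨e, he⟩, z f * G.coboundary p f := by
    rw [Finset.sum_map]
    refine Finset.sum_congr rfl fun i _ => ?_
    rw [Function.Embedding.coeFn_mk, (harc i).coboundary p, mul_assoc]
  rw [h1]
  refine (Finset.sum_subset (Finset.subset_univ _) fun f _ hf => ?_).symm
  rw [hz f fun ⟨i, hi⟩ => hf (by simp [← hi]), zero_mul]

theorem IsDirectedCycle.mem_cycleSpace {G : RefGraph V E} {c : E → ℤ}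
    (hc : G.IsDirectedCycle c) : toVec c ∈ G.cycleSpace := by
  obtain ⟨n, v, e, hv, he, harc, hsupp⟩ := hc
  intro p
  rw [G.dotProduct_coboundary_of_cycle he harc fun f hf => by
    rw [← hsupp] at hf; simpa using hf]
  have h1 : ∀ i, toVec c (e i) * c (e i) = 1 := fun i => by
    rw [toVec_apply]
    rcases (harc i).sign_eq with h | h <;> simp [h]
  simp only [h1, one_mul, Finset.sum_sub_distrib]
  rw [sub_eq_zero]
  exact (Equiv.sum_comp (Equiv.addRight (1 : Fin (n + 1))) fun i => p (v i)).symm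

/-- The flows supported on a directed cycle are its multiples. -/
theorem IsDirectedCycle.eq_smul {G : RefGraph V E} {c : E → ℤ} (hc : G.IsDirectedCycle c)
    {z : E → ℝ} (hz : z ∈ G.cycleSpace) (hsub : ∀ e, c e = 0 → z e = 0) :
    ∃ t : ℝ, z = t • toVec c := by
  classical
  obtain ⟨n, v, e, hv, he, harc, hsupp⟩ := hc
  have hoff : ∀ f, f ∉ Set.range e → c f = 0 := fun f hf => by
    rw [← hsupp] at hf; simpa using hf
  have hcc : ∀ i, (c (e i) : ℝ) * c (e i) = 1 := fun i => by
    rcases (harc i).sign_eq with h | h <;> simp [h]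
  -- Conservation at `v (j + 1)`, by pairing with its indicator potential: the flow entering along
  -- `e j` leaves along `e (j + 1)`.
  have hstep : ∀ j : Fin (n + 1), z (e (j + 1)) * c (e (j + 1)) = z (e j) * c (e j) := by
    intro j
    have h1 := hz (Pi.single (v (j + 1)) 1)
    rw [G.dotProduct_coboundary_of_cycle he harc fun f hf => hsub f (hoff f hf)] at h1
    simp only [mul_sub, Finset.sum_sub_distrib, Pi.single_apply, hv.eq_iff, mul_ite, mul_one,
      mul_zero, add_left_inj, Finset.sum_ite_eq', Finset.mem_univ, if_true] at h1
    linarith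
  have hconst : ∀ i : Fin (n + 1), z (e i) * c (e i) = z (e 0) * c (e 0) := by
    intro i
    induction i using Fin.induction with
    | zero => rfl
    | succ i ih => rw [← ih, ← hstep i.castSucc, Fin.coeSucc_eq_succ]
  refine ⟨z (e 0) * c (e 0), funext fun f => ?_⟩
  rw [Pi.smul_apply, smul_eq_mul, toVec_apply]
  by_cases hf : f ∈ Set.range e
  · obtain ⟨i, rfl⟩ := hf
    rw [← hconst i, mul_assoc, hcc, mul_one]
  · rw [hsub f (hoff f hf), hoff f hf]; simp

/-- The edge `e` goes from `u` to `v` when directed as the flow `z`. -/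
def FlowArc (z : E → ℝ) (u : V) (e : E) (v : V) : Prop :=
  (0 < z e ∧ G.tail e = u ∧ G.head e = v) ∨ (z e < 0 ∧ G.head e = u ∧ G.tail e = v)

/-- Conservation at `v`: if no arc left `v`, every term of the pairing with the indicator potential
of `v` would be nonpositive, and that of `e` negative. -/
theorem FlowArc.exists_next {G : RefGraph V E} {z : E → ℝ} (hz : z ∈ G.cycleSpace) {u v : V}
    {e : E} (h : G.FlowArc z u e v) : ∃ e' v', G.FlowArc z v e' v' := by
  classical
  by_contra! hno
  have h0 := hz (Pi.single v 1)
  have hterm : ∀ f, z f * G.coboundary (Pi.single v 1) f ≤ 0 := by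
    intro f
    have h1 := hno f
    rw [coboundary_apply, Pi.single_apply, Pi.single_apply]
    unfold FlowArc at h1
    rcases lt_trichotomy (z f) 0 with h2 | h2 | h2
    · rw [if_neg (c := G.head f = v) fun h3 => h1 _ (Or.inr ⟨h2, h3, rfl⟩)]
      split_ifs <;> linarith
    · simp [h2]
    · rw [if_neg (c := G.tail f = v) fun h3 => h1 _ (Or.inl ⟨h2, h3, rfl⟩)]
      split_ifs <;> linarith
  have he := (Finset.sum_eq_zero_iff_of_nonpos fun f _ => hterm f).1 h0 e (Finset.mem_univ e)
  have h1 := hno e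
  unfold FlowArc at h1
  rw [coboundary_apply, Pi.single_apply, Pi.single_apply] at he
  rcases h with ⟨h2, h3, h4⟩ | ⟨h2, h3, h4⟩
  · rw [if_pos h4, if_neg fun h3 => h1 _ (Or.inl ⟨h2, h3, rfl⟩)] at he
    linarith
  · rw [if_pos h4, if_neg (c := G.head e = v) fun h3 => h1 _ (Or.inr ⟨h2, h3, rfl⟩)] at he
    linarith

/-- A nonzero flow conforms to a directed cycle. -/
theorem exists_directedCycle_conformal [Finite V] {z : E → ℝ} (hz : z ∈ G.cycleSpace)
    (hne : z ≠ 0) : ∃ c, G.IsDirectedCycle c ∧ ∀ e, c e ≠ 0 → 0 < (c e : ℝ) * z e := by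
  classical
  let X := {u : V // ∃ e v, G.FlowArc z u e v}
  have hnext : ∀ u : X, ∃ (e : E) (v : X), G.FlowArc z u e v := fun ⟨u, e, v, h⟩ =>
    ⟨e, ⟨v, h.exists_next hz⟩, h⟩
  choose ed nx hnx using hnext
  obtain ⟨e₀, he₀⟩ : ∃ e, z e ≠ 0 := by
    by_contra! h
    exact hne (funext h)
  obtain ⟨x₀⟩ : Nonempty X := by
    rcases lt_or_gt_of_ne he₀ with h | h
    · exact ⟨⟨_, e₀, _, Or.inr ⟨h, rfl, rfl⟩⟩⟩
    · exact ⟨⟨_, e₀, _, Or.inl ⟨h, rfl, rfl⟩⟩⟩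
  -- Following the flow is a self-map of a finite set, so it has a periodic point. Over one minimal
  -- period the vertices are distinct, and so are the edges, since the sign of `z` fixes the
  -- starting vertex of an edge.
  obtain ⟨x, hx⟩ : ∃ x : X, x ∈ Function.periodicPts nx := by
    obtain ⟨i, j, hij, h⟩ := Finite.exists_ne_map_eq_of_infinite fun n : ℕ => nx^[n] x₀
    wlog hlt : i < j generalizing i j
    · exact this j i hij.symm h.symm (lt_of_le_of_ne (not_lt.1 hlt) hij.symm)
    refine ⟨nx^[i] x₀, Function.mk_mem_periodicPts (Nat.sub_pos_of_lt hlt) ?_⟩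
    change nx^[j - i] (nx^[i] x₀) = nx^[i] x₀
    rw [← Function.iterate_add_apply, Nat.sub_add_cancel hlt.le]
    exact h.symm
  obtain ⟨n, hn⟩ : ∃ n, Function.minimalPeriod nx x = n + 1 :=
    Nat.exists_eq_succ_of_ne_zero (Function.minimalPeriod_pos_of_mem_periodicPts hx).ne'
  let vx : Fin (n + 1) → X := fun i => nx^[(i : ℕ)] x
  have hvx : Function.Injective vx := by
    intro i j hij
    have := Function.iterate_injOn_Iio_minimalPeriod (f := nx) (x := x)
      (Set.mem_Iio.2 (i.isLt.trans_eq hn.symm))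
      (Set.mem_Iio.2 (j.isLt.trans_eq hn.symm)) hij
    exact Fin.ext this
  have hstep : ∀ i, vx (i + 1) = nx (vx i) := by
    intro i
    change nx^[((i + 1 : Fin (n + 1)) : ℕ)] x = nx (nx^[(i : ℕ)] x)
    rw [← Function.iterate_succ_apply' nx]
    by_cases hi : i = Fin.last n
    · subst hi
      rw [Fin.last_add_one, Fin.val_last, Fin.val_zero, Nat.succ_eq_add_one, ← hn,
        Function.iterate_minimalPeriod]
      rfl
    · rw [Fin.val_add_one_of_lt (lt_of_le_of_ne (Fin.le_last i) hi)]
  let e : Fin (n + 1) → E := fun i => ed (vx i)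
  have he : Function.Injective e := by
    intro i j hij
    refine hvx (Subtype.ext ?_)
    have h1 := hnx (vx i)
    have h2 := hnx (vx j)
    have hij : ed (vx i) = ed (vx j) := hij
    rw [hij] at h1
    rcases h1 with ⟨a1, b1, -⟩ | ⟨a1, b1, -⟩ <;> rcases h2 with ⟨a2, b2, -⟩ | ⟨a2, b2, -⟩
    · rw [← b1, ← b2]
    · linarith
    · linarith
    · rw [← b1, ← b2]
  let c : E → ℤ := fun f => if f ∈ Set.range e then (if 0 < z f then 1 else -1) else 0
  have hc : ∀ i, c (e i) = if 0 < z (e i) then 1 else -1 := fun i => if_pos ⟨i, rfl⟩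
  refine ⟨c, ⟨n, fun i => vx i, e, Subtype.val_injective.comp hvx, he, fun i => ?_, ?_⟩, ?_⟩
  · change G.IsArc (e i) (c (e i)) (vx i) (vx (i + 1))
    rw [hc, hstep]
    rcases hnx (vx i) with ⟨h1, h2, h3⟩ | ⟨h1, h2, h3⟩
    · exact Or.inl ⟨if_pos h1, h2, h3⟩
    · exact Or.inr ⟨if_neg (not_lt.2 h1.le), h2, h3⟩
  · ext f
    simp only [Function.mem_support, c]
    split_ifs with h1 h2 <;> simp [h1]
  · intro f hf
    by_cases h1 : f ∈ Set.range e
    · obtain ⟨i, rfl⟩ := h1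
      rw [hc]
      rcases hnx (vx i) with ⟨h1, -, -⟩ | ⟨h1, -, -⟩
      · rw [if_pos h1]; push_cast; rw [one_mul]; exact h1
      · rw [if_neg (not_lt.2 h1.le)]; push_cast; rw [neg_one_mul]; exact neg_pos.2 h1
    · exact absurd (if_neg h1) hf

/-- The directed cycles are elementary vectors of the cycle space. -/
theorem isElementarySystem_cycle [Finite V] :
    IsElementarySystem G.IsDirectedCycle G.cycleSpace where
  mem := fun c hc => hc.mem_cycleSpace
  values := fun c hc => hc.values
  neg := fun c hc => hc.neg
  nonzero := by
    rintro c ⟨n, v, e, hv, he, harc, hsupp⟩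
    refine ⟨e 0, ?_⟩
    rcases (harc 0).sign_eq with h | h <;> simp [h]
  conformal := fun z hz hne => G.exists_directedCycle_conformal hz hne
  eq_or_neg := by
    intro c c' hc hc' hsupp
    obtain ⟨t, ht⟩ := hc'.eq_smul hc.mem_cycleSpace fun e he => by
      have : e ∉ Function.support c := by rw [hsupp]; simpa using he
      simpa using this
    obtain ⟨n, v, e, hv, he, harc, hs⟩ := hc
    have h0 : c (e 0) = 1 ∨ c (e 0) = -1 := (harc 0).sign_eq
    have h0' : c' (e 0) = 1 ∨ c' (e 0) = -1 := by
      refine (hc'.values (e 0)).resolve_left fun h => ?_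
      have : e 0 ∈ Function.support c' := by rw [← hsupp, hs]; exact ⟨0, rfl⟩
      exact this h
    have h1 := congrFun ht (e 0)
    rw [Pi.smul_apply, smul_eq_mul, toVec_apply, toVec_apply] at h1
    have h2 : t = 1 ∨ t = -1 := by
      rcases h0 with h0 | h0 <;> rcases h0' with h0' | h0' <;> rw [h0, h0'] at h1 <;>
        push_cast at h1
      · left; linarith
      · right; linarith
      · right; linarith
      · left; linarith
    rcases h2 with rfl | rfl
    · left
      funext f
      have := congrFun ht f
      simpa using this
    · right
      funext f
      have := congrFun ht f
      simp only [neg_smul, one_smul, Pi.neg_apply, toVec_apply] at this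
      rw [Pi.neg_apply]
      exact_mod_cast this

end RefGraph

/-! ### Weights inducing the signatures; fundamental cycles and cocycles of trees -/

namespace RefGraph

variable {V E : Type*} {G : RefGraph V E}

theorem CocycleSignature.eq_or_eq_neg [Finite V] [Finite E] (σs : G.CocycleSignature) {d : E → ℤ}
    (hd : G.IsDirectedCocycle d) : ∃ C, d = σs.dir C ∨ d = -σs.dir C := by
  obtain ⟨W, hW, rfl⟩ := hd
  refine ⟨⟨G.cut W, hW⟩, G.isElementarySystem_cocycle.eq_or_neg _ _ ⟨W, hW, rfl⟩
    (σs.isDirectedCocycle _) ?_⟩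
  rw [σs.support_dir, support_directedCut]

/-- Adjacent vertices of `(V, T)` are joined by a directed edge of `T`. -/
theorem exists_of_toSimple_adj {T : Set E} {u v : V} (h : (G.toSimple T).Adj u v) :
    ∃ e ∈ T, ∃ s : ℤ, G.IsArc e s u v := by
  rw [toSimple, SimpleGraph.fromRel_adj] at h
  rcases h.2 with ⟨e, he, h1, h2⟩ | ⟨e, he, h1, h2⟩
  · exact ⟨e, he, 1, Or.inl ⟨rfl, h1, h2⟩⟩
  · exact ⟨e, he, -1, Or.inr ⟨rfl, h2, h1⟩⟩

theorem reachable_of_mem {T : Set E} {e : E} (he : e ∈ T) :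
    (G.toSimple T).Reachable (G.tail e) (G.head e) := by
  by_cases h : G.tail e = G.head e
  · rw [h]
  · refine SimpleGraph.Adj.reachable ?_
    rw [toSimple, SimpleGraph.fromRel_adj]
    exact ⟨h, Or.inl ⟨e, he, rfl, rfl⟩⟩

variable [Fintype E]

theorem CycleSignature.eq_or_eq_neg [Finite V] (σ : G.CycleSignature) {c : E → ℤ}
    (hc : G.IsDirectedCycle c) : ∃ C, c = σ.dir C ∨ c = -σ.dir C := by
  refine ⟨⟨Function.support c, c, hc, rfl⟩, G.isElementarySystem_cycle.eq_or_neg _ _ hc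
    (σ.isDirectedCycle _) ?_⟩
  rw [σ.support_dir]

theorem linearMap_eq_dotProduct (f : (E → ℝ) →ₗ[ℝ] ℝ) : ∃ w : E → ℝ, ∀ z, f z = w ⬝ᵥ z := by
  classical
  refine ⟨fun e => f (Pi.single e 1), fun z => ?_⟩
  rw [LinearMap.pi_apply_eq_sum_univ f z]
  refine Finset.sum_congr rfl fun e _ => ?_
  rw [smul_eq_mul, mul_comm]
  congr 3
  funext e'
  simp [Pi.single_apply, eq_comm]

/-- An acyclic cycle signature is induced by a weight vector. -/
theorem CycleSignature.IsAcyclic.exists_weight {σ : G.CycleSignature} (h : σ.IsAcyclic) :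
    ∃ w : E → ℝ, ∀ C, 0 < w ⬝ᵥ toVec (σ.dir C) := by
  classical
  obtain ⟨f, -, hf⟩ := exists_linearMap_pos_of_sum_notMem (⊥ : Submodule ℝ (E → ℝ))
    (fun C => toVec (σ.dir C)) fun a ha hsum => h a ha fun e => by
      have h1 := congrFun ((Submodule.mem_bot ℝ).1 hsum) e
      rw [Finset.sum_apply] at h1
      convert h1 <;> rfl
  obtain ⟨w, hw⟩ := linearMap_eq_dotProduct f
  exact ⟨w, fun C => hw _ ▸ hf C⟩

/-- An acyclic cocycle signature is induced by a weight vector. -/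
theorem CocycleSignature.IsAcyclic.exists_weight {σs : G.CocycleSignature} (h : σs.IsAcyclic) :
    ∃ w : E → ℝ, ∀ C, 0 < w ⬝ᵥ toVec (σs.dir C) := by
  classical
  obtain ⟨f, -, hf⟩ := exists_linearMap_pos_of_sum_notMem (⊥ : Submodule ℝ (E → ℝ))
    (fun C => toVec (σs.dir C)) fun a ha hsum => h a ha fun e => by
      have h1 := congrFun ((Submodule.mem_bot ℝ).1 hsum) e
      rw [Finset.sum_apply] at h1
      convert h1 <;> rfl
  obtain ⟨w, hw⟩ := linearMap_eq_dotProduct f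
  exact ⟨w, fun C => hw _ ▸ hf C⟩

section Weights

variable [Finite V] {σ : G.CycleSignature} {σs : G.CocycleSignature} {w w' : E → ℝ}

/-- The two directions of a cycle have opposite weights, so the sign of the weight tells which one
is chosen. -/
theorem CycleSignature.mem_range_iff (hw : ∀ C, 0 < w ⬝ᵥ toVec (σ.dir C)) {c : E → ℤ}
    (hc : G.IsDirectedCycle c) : c ∈ Set.range σ.dir ↔ 0 < w ⬝ᵥ toVec c := by
  constructor
  · rintro ⟨C, rfl⟩
    exact hw C
  · intro h
    obtain ⟨C, rfl | rfl⟩ := σ.eq_or_eq_neg hc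
    · exact ⟨C, rfl⟩
    · rw [toVec_neg, dotProduct_neg] at h
      linarith [hw C]

theorem CocycleSignature.mem_range_iff (hw' : ∀ C, 0 < w' ⬝ᵥ toVec (σs.dir C)) {d : E → ℤ}
    (hd : G.IsDirectedCocycle d) : d ∈ Set.range σs.dir ↔ 0 < w' ⬝ᵥ toVec d := by
  constructor
  · rintro ⟨C, rfl⟩
    exact hw' C
  · intro h
    obtain ⟨C, rfl | rfl⟩ := σs.eq_or_eq_neg hd
    · exact ⟨C, rfl⟩
    · rw [toVec_neg, dotProduct_neg] at h
      linarith [hw' C]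

theorem CycleSignature.dotProduct_ne_zero (hw : ∀ C, 0 < w ⬝ᵥ toVec (σ.dir C)) {c : E → ℤ}
    (hc : G.IsDirectedCycle c) : w ⬝ᵥ toVec c ≠ 0 := by
  obtain ⟨C, rfl | rfl⟩ := σ.eq_or_eq_neg hc
  · exact (hw C).ne'
  · rw [toVec_neg, dotProduct_neg]
    exact neg_ne_zero.2 (hw C).ne'

theorem CocycleSignature.dotProduct_ne_zero (hw' : ∀ C, 0 < w' ⬝ᵥ toVec (σs.dir C)) {d : E → ℤ}
    (hd : G.IsDirectedCocycle d) : w' ⬝ᵥ toVec d ≠ 0 := by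
  obtain ⟨C, rfl | rfl⟩ := σs.eq_or_eq_neg hd
  · exact (hw' C).ne'
  · rw [toVec_neg, dotProduct_neg]
    exact neg_ne_zero.2 (hw' C).ne'

theorem CycleSignature.compatible_iff (hw : ∀ C, 0 < w ⬝ᵥ toVec (σ.dir C))
    (O : DiscreteOrientation E) : σ.Compatible O ↔ WeightCompatible G.IsDirectedCycle w O :=
  forall₃_congr fun _ hc _ => CycleSignature.mem_range_iff hw hc

theorem CocycleSignature.compatible_iff (hw' : ∀ C, 0 < w' ⬝ᵥ toVec (σs.dir C))
    (O : DiscreteOrientation E) : σs.Compatible O ↔ WeightCompatible G.IsDirectedCocycle w' O :=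
  forall₃_congr fun _ hd _ => CocycleSignature.mem_range_iff hw' hd

end Weights

/-- The flow along a path in `T`. -/
theorem exists_path_flow {T : Set E} {u v : V} (h : (G.toSimple T).Reachable u v) :
    ∃ f : E → ℝ, (∀ e, e ∉ T → f e = 0) ∧ ∀ p, f ⬝ᵥ G.coboundary p = p u - p v := by
  classical
  obtain ⟨walk⟩ := h
  induction walk with
  | nil => exact ⟨0, fun _ _ => rfl, fun p => by simp⟩
  | cons hadj _ ih =>
    obtain ⟨f, hf, hfp⟩ := ih
    obtain ⟨e, he, s, harc⟩ := exists_of_toSimple_adj hadj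
    refine ⟨Pi.single e (s : ℝ) + f, fun e' he' => ?_, fun p => ?_⟩
    · have : e' ≠ e := fun h => he' (h ▸ he)
      simp [this, hf e' he']
    · rw [add_dotProduct, hfp, single_dotProduct, harc.coboundary p, ← mul_assoc]
      have : (s : ℝ) * s = 1 := by
        rcases harc.sign_eq with h | h <;> simp [h]
      rw [this]; ring

/-- Pairing the potential difference with the flow along a path in `T` gives `p u - p v`. -/
theorem eq_of_coboundary_eq_zero {T : Set E} (hT : (G.toSimple T).Connected) {p : V → ℝ}
    (h : ∀ e ∈ T, G.coboundary p e = 0) (u v : V) : p u = p v := by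
  obtain ⟨f, hf, hfp⟩ := exists_path_flow (hT.preconnected u v)
  have h1 := hfp p
  rw [dotProduct, Finset.sum_eq_zero fun e _ => ?_] at h1
  · linarith
  · by_cases he : e ∈ T
    · rw [h e he, mul_zero]
    · rw [hf e he, zero_mul]

theorem eq_zero_of_mem_cutSpace {T : Set E} (hT : (G.toSimple T).Connected) {b : E → ℝ}
    (hb : b ∈ G.cutSpace) (h : ∀ e ∈ T, b e = 0) : b = 0 := by
  obtain ⟨p, rfl⟩ := hb
  funext e
  rw [coboundary_apply, eq_of_coboundary_eq_zero hT h (G.tail e) (G.head e), sub_self]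
  rfl

theorem eq_zero_of_mem_cycleSpace [Finite V] {T : Set E} (hT : ∀ C, G.IsCycle C → ¬ C ⊆ T)
    {z : E → ℝ} (hz : z ∈ G.cycleSpace) (h : ∀ e, e ∉ T → z e = 0) : z = 0 := by
  by_contra hne
  obtain ⟨c, hc, hcz⟩ := G.exists_directedCycle_conformal hz hne
  refine hT _ ⟨c, hc, rfl⟩ fun e he => ?_
  by_contra heT
  have := hcz e he
  rw [h e heT, mul_zero] at this
  exact lt_irrefl _ this

/-- A set of edges that meets every cocycle connects the vertices of a connected graph. -/
theorem connected_of_forall_meets [Finite V] (hG : G.Connected) {T : Set E}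
    (h : ∀ d, G.IsDirectedCocycle d → ∃ e ∈ T, d e ≠ 0) : (G.toSimple T).Connected := by
  have := hG.nonempty
  refine (SimpleGraph.connected_iff _).2 ⟨fun u v => ?_, hG.nonempty⟩
  let W : Set V := {v | (G.toSimple T).Reachable u v}
  have hWT : ∀ e ∈ T, G.coboundary (W.indicator 1) e = 0 := by
    intro e he
    have h1 : G.tail e ∈ W ↔ G.head e ∈ W :=
      ⟨fun h => h.trans (reachable_of_mem he), fun h => h.trans (reachable_of_mem he).symm⟩
    classical
    rw [coboundary_apply]
    simp only [Set.indicator_apply, Pi.one_apply, h1, sub_self]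
  -- Otherwise a cocycle conforming to the boundary of the `T`-component of `u` would avoid `T`.
  have hzero : G.coboundary (W.indicator 1) = 0 := by
    by_contra hne
    obtain ⟨d, hd, hdb⟩ := G.exists_directedCocycle_conformal ⟨_, rfl⟩ hne
    obtain ⟨e, heT, he⟩ := h d hd
    have := hdb e he
    rw [hWT e heT, mul_zero] at this
    exact lt_irrefl _ this
  have huv := eq_of_coboundary_eq_zero hG (p := W.indicator 1) (fun e _ => congrFun hzero e) u v
  have hu : u ∈ W := SimpleGraph.Reachable.refl u
  by_contra hv
  have hv : v ∉ W := hv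
  rw [Set.indicator_of_mem hu, Set.indicator_of_notMem hv] at huv
  exact one_ne_zero huv

/-- The fundamental cycle of `e ∉ T`, in either direction. -/
theorem IsSpanningTree.exists_fundamental_cycle [Finite V] {T : Set E} (hT : G.IsSpanningTree T)
    {e : E} (he : e ∉ T) {s : ℤ} (hs : s = 1 ∨ s = -1) :
    ∃ c, G.IsDirectedCycle c ∧ c e = s ∧ ∀ f, c f ≠ 0 → f ∈ T ∨ f = e := by
  classical
  obtain ⟨f, hf, hfp⟩ := exists_path_flow (hT.1.preconnected (G.tail e) (G.head e))
  have hss : (s : ℝ) * s = 1 := by rcases hs with h | h <;> simp [h]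
  -- The edge `e` closed up by the return path in `T`. A directed cycle conforming to `z` must use
  -- `e`, because `T` contains no cycle.
  set z : E → ℝ := (s : ℝ) • (Pi.single e 1 - f) with hz
  have hze : z e = s := by simp [hz, hf e he]
  have hzmem : z ∈ G.cycleSpace := by
    refine Submodule.smul_mem _ _ fun p => ?_
    rw [sub_dotProduct, single_dotProduct, hfp, coboundary_apply]; ring
  obtain ⟨c, hc, hcz⟩ := G.exists_directedCycle_conformal hzmem fun h0 => by
    rw [h0] at hze
    rw [← hze] at hss
    simp at hss
  have hsub : ∀ f, c f ≠ 0 → f ∈ T ∨ f = e := by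
    intro f' hf'
    by_contra! hne
    have := hcz f' hf'
    simp [hz, hf f' hne.1, hne.2] at this
  have hce : c e ≠ 0 := by
    intro h0
    refine hT.2 _ ⟨c, hc, rfl⟩ fun f' hf' => (hsub f' hf').resolve_right ?_
    rintro rfl
    exact hf' h0
  refine ⟨c, hc, ?_, hsub⟩
  have h1 := hcz e hce
  rw [hze] at h1
  rcases hs with rfl | rfl <;> rcases (hc.values e).resolve_left hce with h2 | h2 <;>
    rw [h2] at h1 ⊢ <;> norm_num at h1

/-- The fundamental cocycle of `e ∈ T`, in either direction. -/
theorem IsSpanningTree.exists_fundamental_cocycle [Finite V] {T : Set E}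
    (hT : G.IsSpanningTree T) {e : E} (he : e ∈ T) {s : ℤ} (hs : s = 1 ∨ s = -1) :
    ∃ d, G.IsDirectedCocycle d ∧ d e = s ∧ ∀ f, d f ≠ 0 → f ∉ T ∨ f = e := by
  classical
  have hss : (s : ℝ) * s = 1 := by rcases hs with h | h <;> simp [h]
  -- The side of `G.tail e` once `e` is removed from the tree. The head is on the other side, as a
  -- path in `T \ {e}` would close `e` to a nonzero flow inside `T`.
  let W : Set V := {v | (G.toSimple (T \ {e})).Reachable (G.tail e) v}
  have htail : G.tail e ∈ W := SimpleGraph.Reachable.refl _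
  have hhead : G.head e ∉ W := by
    intro h
    obtain ⟨f, hf, hfp⟩ := exists_path_flow h
    have h1 : (Pi.single e 1 - f : E → ℝ) = 0 := by
      refine eq_zero_of_mem_cycleSpace hT.2 (fun p => ?_) fun f' hf' => ?_
      · rw [sub_dotProduct, single_dotProduct, hfp, coboundary_apply]; ring
      · have : f' ≠ e := fun h => hf' (h ▸ he)
        simp [this, hf f' fun h => hf' h.1]
    have h2 := congrFun h1 e
    simp [hf e fun h => h.2 rfl] at h2
  set b : E → ℝ := (s : ℝ) • G.coboundary (W.indicator 1) with hb
  have hbe : b e = s := by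
    rw [hb, Pi.smul_apply, coboundary_apply, Set.indicator_of_mem htail,
      Set.indicator_of_notMem hhead]
    simp
  have hbT : ∀ f ∈ T, f ≠ e → b f = 0 := by
    intro f hf hfe
    have h1 : G.tail f ∈ W ↔ G.head f ∈ W :=
      have hr := reachable_of_mem (G := G) (show f ∈ T \ {e} from ⟨hf, hfe⟩)
      ⟨fun h => h.trans hr, fun h => h.trans hr.symm⟩
    rw [hb, Pi.smul_apply, coboundary_apply]
    simp only [Set.indicator_apply, Pi.one_apply, h1, sub_self, smul_zero]
  obtain ⟨d, hd, hdb⟩ := G.exists_directedCocycle_conformal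
    (G.cutSpace.smul_mem (s : ℝ)
      (show G.coboundary (W.indicator 1) ∈ G.cutSpace from ⟨_, rfl⟩)) fun h0 => by
      have h1 : b = 0 := h0
      rw [h1] at hbe
      rw [← hbe] at hss
      simp at hss
  replace hdb : ∀ e, d e ≠ 0 → 0 < (d e : ℝ) * b e := hdb
  have hsub : ∀ f, d f ≠ 0 → f ∉ T ∨ f = e := by
    intro f hf
    by_contra! hne
    have := hdb f hf
    rw [hbT f hne.1 hne.2, mul_zero] at this
    exact lt_irrefl _ this
  have hde : d e ≠ 0 := by
    intro h0
    have h1 := eq_zero_of_mem_cutSpace hT.1 (G.isElementarySystem_cocycle.mem d hd) fun f hf => by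
      by_contra h1
      have h2 : d f ≠ 0 := by simpa using h1
      rcases hsub f h2 with h3 | rfl
      · exact h3 hf
      · exact h2 h0
    obtain ⟨f, hf⟩ := G.isElementarySystem_cocycle.nonzero d hd
    have := congrFun h1 f
    exact hf (by simpa using this)
  refine ⟨d, hd, ?_, hsub⟩
  have h1 := hdb e hde
  rw [hbe] at h1
  rcases hs with rfl | rfl <;>
    rcases (G.isElementarySystem_cocycle.values d hd e).resolve_left hde with h2 | h2 <;>
    rw [h2] at h1 ⊢ <;> norm_num at h1

end RefGraph

/-! ### Spanning trees from linear programming, and tree solutions -/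

/-- A nonnegative vector stays nonnegative when moved a little in a direction that is nonnegative
wherever the vector vanishes. -/
theorem exists_pos_forall_add_mul_nonneg {ι : Type*} [Finite ι] {α β : ι → ℝ}
    (hα : ∀ i, 0 ≤ α i) (h : ∀ i, α i = 0 → 0 ≤ β i) : ∃ ε > 0, ∀ i, 0 ≤ α i + ε * β i := by
  have hev : ∀ i, ∀ᶠ ε in nhdsWithin (0 : ℝ) (Set.Ioi 0), 0 ≤ α i + ε * β i := by
    intro i
    rcases (hα i).eq_or_lt with h0 | h0
    · filter_upwards [self_mem_nhdsWithin] with ε hε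
      rw [← h0, zero_add]
      exact mul_nonneg (le_of_lt hε) (h i h0.symm)
    · have hc : Filter.Tendsto (fun ε : ℝ => α i + ε * β i) (nhds 0) (nhds (α i + 0 * β i)) :=
        Continuous.tendsto (by fun_prop) 0
      rw [zero_mul, add_zero] at hc
      filter_upwards [(hc.eventually (lt_mem_nhds h0)).filter_mono nhdsWithin_le_nhds] with ε hε
      exact hε.le
  obtain ⟨ε, hε, hpos⟩ := ((Filter.eventually_all.2 hev).and self_mem_nhdsWithin).exists
  exact ⟨ε, hpos, hε⟩

namespace RefGraph

variable {V E : Type*} [Finite V] [Fintype E] {G : RefGraph V E}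
  {σ : G.CycleSignature} {σs : G.CocycleSignature} {w w' : E → ℝ}

/-- Every compatible orientation comes from a spanning tree: the support of the minimal solution of
a linear program. -/
theorem exists_isTreeOrientation (hG : G.Connected) (hw : ∀ C, 0 < w ⬝ᵥ toVec (σ.dir C))
    (hw' : ∀ C, 0 < w' ⬝ᵥ toVec (σs.dir C)) {O : DiscreteOrientation E} (hO : σ.Compatible O)
    (hO' : σs.Compatible O) : ∃ T, IsTreeOrientation σ σs T O := by
  rw [CycleSignature.compatible_iff hw] at hO
  rw [CocycleSignature.compatible_iff hw'] at hO'
  obtain ⟨g, hg, hgw⟩ := G.isElementarySystem_cycle.exists_positive_representative hO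
  obtain ⟨g', hg', hgw'⟩ := G.isElementarySystem_cocycle.exists_positive_representative hO'
  have hss := O.sign_mul_self
  -- The feasible points of the program costing at most as much as the feasible point `g'`. The cost
  -- `g` is positive along `O`, so this set is bounded.
  let K : Set (E → ℝ) := {x | (∀ e, 0 ≤ (O.sign e : ℝ) * x e) ∧ x - g' ∈ G.cycleSpace ∧
    g ⬝ᵥ x ≤ g ⬝ᵥ g'}
  have hcont : Continuous fun x : E → ℝ => g ⬝ᵥ x := by
    unfold dotProduct; fun_prop
  have hK : IsCompact K := by
    refine IsCompact.of_isClosed_subset (isCompact_univ_pi fun e =>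
      isCompact_Icc (a := -(g ⬝ᵥ g' / (O.sign e * g e))) (b := g ⬝ᵥ g' / (O.sign e * g e))) ?_ ?_
    · refine IsClosed.inter ?_ (IsClosed.inter ?_ ?_)
      · have : IsClosed (⋂ e, {x : E → ℝ | 0 ≤ (O.sign e : ℝ) * x e}) :=
          isClosed_iInter fun e => isClosed_le continuous_const (by fun_prop)
        have h : {x : E → ℝ | ∀ e, 0 ≤ (O.sign e : ℝ) * x e} =
            ⋂ e, {x : E → ℝ | 0 ≤ (O.sign e : ℝ) * x e} := by
          ext x; simp
        change IsClosed {x : E → ℝ | ∀ e, 0 ≤ (O.sign e : ℝ) * x e}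
        rw [h]
        exact this
      · exact G.cycleSpace.closed_of_finiteDimensional.preimage (by fun_prop : Continuous
          fun x : E → ℝ => x - g')
      · exact isClosed_le hcont continuous_const
    · intro x hx e _
      rw [Set.mem_Icc, ← abs_le, le_div_iff₀ (hg e)]
      have habs : |x e| = O.sign e * x e := by
        have := hx.1 e
        rcases O.sign_eq_or e with h | h <;> rw [h] at this ⊢ <;> push_cast at this ⊢
        · rw [one_mul] at this ⊢; exact abs_of_nonneg this
        · rw [neg_one_mul] at this ⊢; exact abs_of_nonpos (by linarith)
      have hterm : ∀ e, g e * x e = (O.sign e * x e) * (O.sign e * g e) := fun e => by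
        linear_combination (-(g e * x e)) * hss e
      rw [habs, ← hterm]
      refine le_trans ?_ hx.2.2
      refine Finset.single_le_sum (f := fun e => g e * x e) (fun e _ => ?_) (Finset.mem_univ e)
      rw [hterm]
      exact mul_nonneg (hx.1 e) (hg e).le
  obtain ⟨x, hx, hmin⟩ := hK.exists_isMinOn
    ⟨g', fun e => (hg' e).le, by simp, le_rfl⟩ hcont.continuousOn
  -- First-order optimality: feasible directions do not decrease the cost, which agrees with `w` on
  -- the cycle space.
  have hopt : ∀ z ∈ G.cycleSpace, (∀ e, x e = 0 → 0 ≤ (O.sign e : ℝ) * z e) → 0 ≤ w ⬝ᵥ z := by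
    intro z hz hze
    by_contra! hneg
    obtain ⟨ε, hε, hpos⟩ := exists_pos_forall_add_mul_nonneg hx.1 fun e h0 => hze e (by
      have := hss e
      have h1 : x e = O.sign e * (O.sign e * x e) := by linear_combination (-x e) * this
      rw [h1, h0, mul_zero])
    have hdot : g ⬝ᵥ (x + ε • z) = g ⬝ᵥ x + ε * (w ⬝ᵥ z) := by
      rw [dotProduct_add, dotProduct_smul, smul_eq_mul, hgw z hz]
    have hlt := mul_neg_of_pos_of_neg hε hneg
    have hxK : x + ε • z ∈ K := by
      refine ⟨fun e => ?_, ?_, ?_⟩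
      · have := hpos e
        simp only [Pi.add_apply, Pi.smul_apply, smul_eq_mul]
        linarith
      · rw [add_sub_right_comm]
        exact G.cycleSpace.add_mem hx.2.1 (G.cycleSpace.smul_mem _ hz)
      · rw [hdot]
        linarith [hx.2.2]
    have := hmin hxK
    simp only [Set.mem_ofPred_eq, hdot] at this
    linarith
  have hxd : ∀ d, G.IsDirectedCocycle d → x ⬝ᵥ toVec d = w' ⬝ᵥ toVec d := by
    intro d hd
    have hdm := G.isElementarySystem_cocycle.mem d hd
    have := G.dotProduct_eq_zero hx.2.1 hdm
    rw [sub_dotProduct, hgw' _ hdm] at this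
    linarith
  have htree : G.IsSpanningTree {e | x e ≠ 0} := by
    refine ⟨connected_of_forall_meets hG fun d hd => ?_, ?_⟩
    · by_contra! h
      refine CocycleSignature.dotProduct_ne_zero hw' hd ?_
      rw [← hxd d hd]
      refine Finset.sum_eq_zero fun e _ => ?_
      by_cases he : x e = 0
      · rw [he, zero_mul]
      · rw [toVec_apply, h e he]; simp
    -- A cycle inside the support could be followed in both directions, which would give it weight
    -- zero.
    · rintro _ ⟨c, hc, rfl⟩ hsub
      have hzero : ∀ e, x e = 0 → c e = 0 := fun e he => by
        by_contra h
        exact hsub h he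
      have h1 := hopt _ hc.mem_cycleSpace fun e he => by simp [hzero e he]
      have h2 := hopt _ hc.neg.mem_cycleSpace fun e he => by simp [hzero e he]
      rw [toVec_neg, dotProduct_neg] at h2
      exact CycleSignature.dotProduct_ne_zero hw hc (by linarith)
  refine ⟨_, htree, fun e he => ?_, fun e he => ?_⟩
  · obtain ⟨c, hc, hce, hsub⟩ := htree.exists_fundamental_cycle he (O.sign_eq_or e)
    have hpos : 0 < w ⬝ᵥ toVec c := by
      refine lt_of_le_of_ne (hopt _ hc.mem_cycleSpace fun f hf => ?_)
        (CycleSignature.dotProduct_ne_zero hw hc).symm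
      by_cases hcf : c f = 0
      · simp [hcf]
      · rcases hsub f hcf with h | rfl
        · exact absurd hf h
        · rw [toVec_apply, hce, hss]; exact zero_le_one
    obtain ⟨C, rfl⟩ := (CycleSignature.mem_range_iff hw hc).2 hpos
    refine ⟨C, fun f hf => ?_, hce⟩
    rw [← σ.support_dir] at hf
    exact hsub f hf
  · obtain ⟨d, hd, hde, hsub⟩ := htree.exists_fundamental_cocycle he (O.sign_eq_or e)
    have hval : w' ⬝ᵥ toVec d = x e * O.sign e := by
      rw [← hxd d hd, dotProduct, Finset.sum_eq_single e, toVec_apply, hde]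
      · intro f _ hfe
        by_cases hdf : d f = 0
        · simp [hdf]
        · have h1 : x f = 0 := not_not.1 ((hsub f hdf).resolve_right hfe)
          rw [h1, zero_mul]
      · intro h; exact absurd (Finset.mem_univ e) h
    have hpos : 0 < w' ⬝ᵥ toVec d := by
      refine lt_of_le_of_ne ?_ (CocycleSignature.dotProduct_ne_zero hw' hd).symm
      rw [hval, mul_comm]
      exact hx.1 e
    obtain ⟨C, rfl⟩ := (CocycleSignature.mem_range_iff hw' hd).2 hpos
    refine ⟨C, fun f hf => ?_, hde⟩
    rw [← σs.support_dir] at hf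
    exact hsub f hf

/-- The tree solution of the cycle problem. -/
theorem IsTreeOrientation.exists_primal {T : Set E} {O : DiscreteOrientation E}
    (hw' : ∀ C, 0 < w' ⬝ᵥ toVec (σs.dir C)) (h : IsTreeOrientation σ σs T O) :
    ∃ x : E → ℝ, x - w' ∈ G.cycleSpace ∧ (∀ e ∈ T, 0 < (O.sign e : ℝ) * x e) ∧
      ∀ e, e ∉ T → x e = 0 := by
  classical
  have hex : ∀ e, ∃ c : E → ℤ, toVec c ∈ G.cycleSpace ∧ (e ∉ T → c e = O.sign e) ∧
      (e ∈ T → c = 0) ∧ ∀ f, c f ≠ 0 → f ∈ T ∨ f = e := by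
    intro e
    by_cases he : e ∈ T
    · refine ⟨0, ?_, fun h => absurd he h, fun _ => rfl, fun f hf => absurd rfl hf⟩
      have : toVec (0 : E → ℤ) = 0 := by funext f; simp
      rw [this]; exact Submodule.zero_mem _
    · obtain ⟨C, hC, hCe⟩ := h.2.1 e he
      refine ⟨σ.dir C, (σ.isDirectedCycle C).mem_cycleSpace, fun _ => hCe,
        fun h => absurd h he, fun f hf => hC ?_⟩
      rw [← σ.support_dir]
      exact hf
  choose c hc hce hcT hsub using hex
  -- Subtracting multiples of fundamental cycles clears the coordinates of `w'` off `T` one by one.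
  -- Each remaining coordinate is then read off by pairing with a fundamental cocycle, which meets
  -- `T` only in that edge.
  let x : E → ℝ := w' - ∑ e, (w' e * O.sign e) • toVec (c e)
  have hxZ : x - w' ∈ G.cycleSpace := by
    have : x - w' = -∑ e, (w' e * O.sign e) • toVec (c e) := by simp [x]
    rw [this]
    exact Submodule.neg_mem _ (Submodule.sum_mem _ fun e _ => Submodule.smul_mem _ _ (hc e))
  have hxT : ∀ e, e ∉ T → x e = 0 := by
    intro e he
    simp only [x, Pi.sub_apply, Finset.sum_apply, Pi.smul_apply, smul_eq_mul, toVec_apply]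
    rw [Finset.sum_eq_single e, hce e he]
    · linear_combination (-w' e) * O.sign_mul_self e
    · intro f _ hfe
      have : c f e = 0 := by
        by_contra h0
        exact (hsub f e h0).elim he fun h => hfe h.symm
      rw [this]; simp
    · intro h; exact absurd (Finset.mem_univ e) h
  refine ⟨x, hxZ, fun e he => ?_, hxT⟩
  obtain ⟨C, hC, hCe⟩ := h.2.2 e he
  have h1 := G.dotProduct_eq_zero hxZ
    (G.isElementarySystem_cocycle.mem _ (σs.isDirectedCocycle C))
  rw [sub_dotProduct, dotProduct, Finset.sum_eq_single e, toVec_apply, hCe] at h1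
  · linarith [hw' C]
  · intro f _ hfe
    by_cases hf : f ∈ T
    · have : σs.dir C f = 0 := by
        by_contra h0
        have h2 : f ∈ Function.support (σs.dir C) := h0
        rw [σs.support_dir] at h2
        exact (hC h2).elim (fun h3 => h3 hf) hfe
      rw [toVec_apply, this]; simp
    · rw [hxT f hf, zero_mul]
  · intro h; exact absurd (Finset.mem_univ e) h

/-- The tree solution of the cocycle problem. -/
theorem IsTreeOrientation.exists_dual {T : Set E} {O : DiscreteOrientation E}
    (hw : ∀ C, 0 < w ⬝ᵥ toVec (σ.dir C)) (h : IsTreeOrientation σ σs T O) :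
    ∃ y : E → ℝ, y - w ∈ G.cutSpace ∧ (∀ e, e ∉ T → 0 < (O.sign e : ℝ) * y e) ∧
      ∀ e ∈ T, y e = 0 := by
  classical
  have hex : ∀ e, ∃ d : E → ℤ, toVec d ∈ G.cutSpace ∧ (e ∈ T → d e = O.sign e) ∧
      (e ∉ T → d = 0) ∧ ∀ f, d f ≠ 0 → f ∉ T ∨ f = e := by
    intro e
    by_cases he : e ∈ T
    · obtain ⟨C, hC, hCe⟩ := h.2.2 e he
      refine ⟨σs.dir C, G.isElementarySystem_cocycle.mem _ (σs.isDirectedCocycle C), fun _ => hCe,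
        fun h => absurd he h, fun f hf => hC ?_⟩
      rw [← σs.support_dir]
      exact hf
    · refine ⟨0, ?_, fun h => absurd h he, fun _ => rfl, fun f hf => absurd rfl hf⟩
      have : toVec (0 : E → ℤ) = 0 := by funext f; simp
      rw [this]; exact Submodule.zero_mem _
  choose d hd hde hdT hsub using hex
  let y : E → ℝ := w - ∑ e, (w e * O.sign e) • toVec (d e)
  have hyB : y - w ∈ G.cutSpace := by
    have : y - w = -∑ e, (w e * O.sign e) • toVec (d e) := by simp [y]
    rw [this]
    exact Submodule.neg_mem _ (Submodule.sum_mem _ fun e _ => Submodule.smul_mem _ _ (hd e))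
  have hyT : ∀ e ∈ T, y e = 0 := by
    intro e he
    simp only [y, Pi.sub_apply, Finset.sum_apply, Pi.smul_apply, smul_eq_mul, toVec_apply]
    rw [Finset.sum_eq_single e, hde e he]
    · linear_combination (-w e) * O.sign_mul_self e
    · intro f _ hfe
      have : d f e = 0 := by
        by_contra h0
        exact (hsub f e h0).elim (fun h => h he) fun h => hfe h.symm
      rw [this]; simp
    · intro h; exact absurd (Finset.mem_univ e) h
  refine ⟨y, hyB, fun e he => ?_, hyT⟩
  obtain ⟨C, hC, hCe⟩ := h.2.1 e he
  have h1 := G.dotProduct_eq_zero (σ.isDirectedCycle C).mem_cycleSpace hyB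
  rw [dotProduct_comm, sub_dotProduct, dotProduct, Finset.sum_eq_single e, toVec_apply, hCe] at h1
  · linarith [hw C]
  · intro f _ hfe
    by_cases hf : f ∈ T
    · rw [hyT f hf, zero_mul]
    · have : σ.dir C f = 0 := by
        by_contra h0
        have h2 : f ∈ Function.support (σ.dir C) := h0
        rw [σ.support_dir] at h2
        exact (hC h2).elim hf hfe
      rw [toVec_apply, this]; simp
  · intro h; exact absurd (Finset.mem_univ e) h

end RefGraph

/-! ### Existence of `φ`, and compatibility of the half-open cells -/

namespace RefGraph

variable {V E : Type*} [Finite V] [Fintype E] {G : RefGraph V E}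
  {σ : G.CycleSignature} {σs : G.CocycleSignature} {w w' : E → ℝ}

/-- A directed cycle and a directed cocycle in the same orientation are disjoint. -/
theorem eq_zero_of_contains {O : DiscreteOrientation E} {c d : E → ℤ} (hc : G.IsDirectedCycle c)
    (hd : G.IsDirectedCocycle d) (hcO : O.Contains c) (hdO : O.Contains d) (e : E)
    (hce : c e ≠ 0) : d e = 0 := by
  by_contra hde
  have h1 : ∀ f, 0 ≤ toVec c f * toVec d f := by
    intro f
    by_cases hcf : c f = 0
    · simp [hcf]
    by_cases hdf : d f = 0
    · simp [hdf]
    rw [toVec_apply, toVec_apply, ← hcO f hcf, ← hdO f hdf, O.sign_mul_self]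
    exact zero_le_one
  have h2 := (Finset.sum_eq_zero_iff_of_nonneg fun f _ => h1 f).1
    (G.dotProduct_eq_zero hc.mem_cycleSpace (G.isElementarySystem_cocycle.mem d hd)) e
    (Finset.mem_univ e)
  rw [toVec_apply, toVec_apply, ← hcO e hce, ← hdO e hde, O.sign_mul_self] at h2
  exact one_ne_zero h2

/-- Data for `φ_{σ,σ*}(O)` exist. -/
theorem exists_isPhiImage (hG : G.Connected) (hw : ∀ C, 0 < w ⬝ᵥ toVec (σ.dir C))
    (hw' : ∀ C, 0 < w' ⬝ᵥ toVec (σs.dir C)) (O : DiscreteOrientation E) :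
    ∃ S, IsPhiImage σ σs O S := by
  obtain ⟨O₁, I, hO₁, hI, hdisjI, rfl⟩ := G.isElementarySystem_cycle.exists_compatible_reversal
    (fun c hc => CycleSignature.dotProduct_ne_zero hw hc) O
  obtain ⟨O₂, J, hO₂, hJ, hdisjJ, rfl⟩ := G.isElementarySystem_cocycle.exists_compatible_reversal
    (fun d hd => CocycleSignature.dotProduct_ne_zero hw' hd) O₁
  set D := ⋃ d ∈ J, Function.support d with hD
  have hneg : ∀ d ∈ J, (O₂.reverse D).Contains (-d) := by
    intro d hd e he
    have he : d e ≠ 0 := by simpa using he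
    rw [O₂.sign_reverse_mem (Set.mem_biUnion hd he), (hJ d hd).2 e he, Pi.neg_apply]
  -- The reversed cocycles are directed in `O₂.reverse D`, so directed cycles of that orientation
  -- avoid `D`. Hence cycles and cocycles can be reversed independently, both starting from `O₂`.
  have hoff : ∀ c, G.IsDirectedCycle c → (O₂.reverse D).Contains c → ∀ e, c e ≠ 0 → e ∉ D := by
    intro c hc hcO e he heD
    obtain ⟨d, hd, hde⟩ := Set.mem_iUnion₂.1 heD
    have := eq_zero_of_contains hc (G.isElementarySystem_cocycle.neg d (hJ d hd).1) hcO
      (hneg d hd) e he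
    exact hde (by simpa using this)
  have hI₂ : ∀ c ∈ I, G.IsDirectedCycle c ∧ O₂.Contains c := by
    intro c hc
    refine ⟨(hI c hc).1, fun e he => ?_⟩
    rw [← (hI c hc).2 e he, O₂.sign_reverse_notMem (hoff c (hI c hc).1 (hI c hc).2 e he)]
  have hcomp : WeightCompatible G.IsDirectedCycle w O₂ := by
    intro c hc hcO
    refine hO₁ c hc fun e he => ?_
    rw [← hcO e he, O₂.sign_reverse_notMem]
    intro heD
    obtain ⟨d, hd, hde⟩ := Set.mem_iUnion₂.1 heD
    exact hde (eq_zero_of_contains hc (hJ d hd).1 hcO (hJ d hd).2 e he)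
  have hσ := (CycleSignature.compatible_iff hw O₂).2 hcomp
  have hσs := (CocycleSignature.compatible_iff hw' O₂).2 hO₂
  obtain ⟨T, hT⟩ := exists_isTreeOrientation hG hw hw' hσ hσs
  refine ⟨_, O₂, T, I, J, hσ, hσs, hT, hI₂, hJ, ?_, ?_, rfl⟩
  · have hcross : ∀ c ∈ I, ∀ d ∈ J, Disjoint (Function.support c) (Function.support d) :=
      fun c hc d hd => Set.disjoint_left.2 fun e hce hde =>
        hde (eq_zero_of_contains (hI₂ c hc).1 (hJ d hd).1 (hI₂ c hc).2 (hJ d hd).2 e hce)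
    rintro c (hc | hc) d (hd | hd) hcd
    · exact hdisjI hc hd hcd
    · exact hcross c hc d hd
    · exact (hcross d hd c hc).symm
    · exact hdisjJ hc hd hcd
  · funext e
    by_cases hA : e ∈ ⋃ c ∈ I, Function.support c
    · have hnD : e ∉ D := by
        obtain ⟨c, hc, hce⟩ := Set.mem_iUnion₂.1 hA
        exact hoff c (hI c hc).1 (hI c hc).2 e hce
      rw [DiscreteOrientation.reverse_apply_mem _ hA, O₂.reverse_apply_notMem hnD,
        O₂.reverse_apply_mem (Or.inl hA)]
    · rw [DiscreteOrientation.reverse_apply_notMem _ hA]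
      by_cases heD : e ∈ D
      · rw [O₂.reverse_apply_mem heD, O₂.reverse_apply_mem (Or.inr heD)]
      · rw [O₂.reverse_apply_notMem heD, O₂.reverse_apply_notMem (by
          rintro (h | h)
          exacts [hA h, heD h])]

/-- The certificate of an image of `φ_{σ,σ*}`; for a `σ*`-compatible orientation no cocycle is
reversed. -/
theorem IsPhiImage.exists_certificate (hw : ∀ C, 0 < w ⬝ᵥ toVec (σ.dir C))
    (hw' : ∀ C, 0 < w' ⬝ᵥ toVec (σs.dir C)) {O : DiscreteOrientation E} {S : Set E}
    (h : IsPhiImage σ σs O S) :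
    ∃ C : PhiCertificate G.cycleSpace G.cutSpace w w' O S, σs.Compatible O → C.D = ∅ := by
  obtain ⟨Ocp, T, I, J, hσ, hσs, hT, hI, hJ, hdisj, hO, hS⟩ := h
  obtain ⟨x, hx, hxT, hx0⟩ := hT.exists_primal hw'
  obtain ⟨y, hy, hyT, hy0⟩ := hT.exists_dual hw
  refine ⟨{
    base := Ocp
    T := T
    A := ⋃ c ∈ I, Function.support c
    D := ⋃ d ∈ J, Function.support d
    x := x
    y := y
    z := (⋃ c ∈ I, Function.support c).indicator fun e => (Ocp.sign e : ℝ)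
    b := (⋃ d ∈ J, Function.support d).indicator fun e => (Ocp.sign e : ℝ)
    x_mem := hx
    y_mem := hy
    z_mem := G.isElementarySystem_cycle.indicator_biUnion_mem Ocp hI
      (hdisj.subset Set.subset_union_left)
    b_mem := G.isElementarySystem_cocycle.indicator_biUnion_mem Ocp hJ
      (hdisj.subset Set.subset_union_right)
    disj := fun e he hde => by
      obtain ⟨c, hc, hce⟩ := Set.mem_iUnion₂.1 he
      obtain ⟨d, hd, hde⟩ := Set.mem_iUnion₂.1 hde
      exact hde (eq_zero_of_contains (hI c hc).1 (hJ d hd).1 (hI c hc).2 (hJ d hd).2 e hce)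
    x_pos := hxT
    x_zero := hx0
    y_pos := hyT
    y_zero := hy0
    z_on := fun e he => Set.indicator_of_mem he _
    z_off := fun e he => Set.indicator_of_notMem he _
    b_on := fun e he => Set.indicator_of_mem he _
    b_off := fun e he => Set.indicator_of_notMem he _
    orient := hO
    S_eq := hS
    tree_indep := fun z hz h => eq_zero_of_mem_cycleSpace hT.1.2 hz h
    tree_span := fun b hb h => eq_zero_of_mem_cutSpace hT.1.1 hb h }, fun hcomp => ?_⟩
  change ⋃ d ∈ J, Function.support d = ∅
  rw [Set.eq_empty_iff_forall_notMem]
  intro e he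
  obtain ⟨d, hd, -⟩ := Set.mem_iUnion₂.1 he
  -- Before its reversal `d` has positive weight by compatibility of `Ocp`; afterwards `-d` lies in
  -- the compatible `O` and would have positive weight too.
  have h1 := (CocycleSignature.mem_range_iff hw' (hJ d hd).1).1 (hσs d (hJ d hd).1 (hJ d hd).2)
  have hneg := G.isElementarySystem_cocycle.neg d (hJ d hd).1
  have h2 := (CocycleSignature.mem_range_iff hw' hneg).1 (hcomp _ hneg fun f hf => by
    have hf : d f ≠ 0 := by simpa using hf
    rw [hO, Ocp.sign_reverse_mem (Or.inr (Set.mem_biUnion hd hf)), (hJ d hd).2 f hf, Pi.neg_apply])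
  rw [toVec_neg, dotProduct_neg] at h2
  linarith

/-- Moving from a point of the half-open cell of `O` along a chosen cocycle leaves the cube. -/
theorem hoc_subset_continuousCompatible (hw' : ∀ C, 0 < w' ⬝ᵥ toVec (σs.dir C))
    {O : DiscreteOrientation E} {S : Set E}
    (C : PhiCertificate G.cycleSpace G.cutSpace w w' O S) (hD : C.D = ∅) :
    O.hoc Sᶜ ⊆ σs.continuousCompatible := by
  rintro x ⟨hxS, hxF⟩
  have hO01 : ∀ e, O.toReal e ∈ Set.Icc (0 : ℝ) 1 := fun e => by
    unfold DiscreteOrientation.toReal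
    split_ifs <;> simp
  have hx01 : ∀ e, x e ∈ Set.Icc (0 : ℝ) 1 := by
    intro e
    by_cases he : e ∈ Sᶜ
    · rcases hxF e he with h | h
      · rw [h]; exact hO01 e
      · exact Set.Ioo_subset_Icc_self h
    · rw [hxS e he]; exact hO01 e
  refine ⟨⟨fun e => (hx01 e).1, fun e => (hx01 e).2⟩, fun ε hε K hmem => ?_⟩
  obtain ⟨k, hk, hkx⟩ := PhiCertificate.exists_abs_le C.x
  have hval : (C.x - (2 * k + 1) • C.z) ⬝ᵥ toVec (σs.dir K) = w' ⬝ᵥ toVec (σs.dir K) := by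
    have hK := G.isElementarySystem_cocycle.mem _ (σs.isDirectedCocycle K)
    have h1 := G.dotProduct_eq_zero C.x_mem hK
    have h2 := G.dotProduct_eq_zero C.z_mem hK
    rw [sub_dotProduct] at h1
    rw [sub_dotProduct, smul_dotProduct, h2, smul_zero]
    linarith
  -- Since `D` is empty, this vector lives on `S`, where it has the signs of `O`. There `x` sits at
  -- the end of the interval chosen by `O`, so a move within the cube goes against `O` and every
  -- term is nonpositive.
  have hle : (C.x - (2 * k + 1) • C.z) ⬝ᵥ toVec (σs.dir K) ≤ 0 := by
    refine Finset.sum_nonpos fun e _ => ?_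
    by_cases he : e ∈ S
    · have hpos := ((C.inImage (M := 2 * k + 1) hkx he).1.signs (by linarith) hk).1
      have hxe := hxS e fun h => h he
      have h0 : 0 ≤ x e + ε * (σs.dir K e : ℝ) := hmem.1 e
      have h1 : x e + ε * (σs.dir K e : ℝ) ≤ 1 := hmem.2 e
      rw [hxe, O.toReal_eq] at h0 h1
      simp only [Pi.sub_apply, Pi.smul_apply, smul_eq_mul, toVec_apply]
      rcases O.sign_eq_or e with h | h <;> rw [h] at hpos h0 h1 <;> push_cast at hpos h0 h1
      · have : (σs.dir K e : ℝ) ≤ 0 := by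
          by_contra! h3
          have := mul_pos hε h3
          linarith
        exact mul_nonpos_of_nonneg_of_nonpos (by linarith) this
      · have : 0 ≤ (σs.dir K e : ℝ) := by
          by_contra! h3
          have := mul_neg_of_pos_of_neg hε h3
          linarith
        exact mul_nonpos_of_nonpos_of_nonneg (by linarith) this
    · have h1 : C.x e = 0 := C.x_zero e fun h => he (by
        rw [C.S_eq, hD, Set.sdiff_empty]; exact Or.inl h)
      have h2 : C.z e = 0 := C.z_off e fun h => he (by
        rw [C.S_eq, hD, Set.sdiff_empty]; exact Or.inr h)
      simp [h1, h2]
  linarith [hw' K]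

/-- A discrete orientation obtained from a compatible continuous one by directing its bi-oriented
edges is compatible. -/
theorem compatible_of_refines {x : E → ℝ} (hx : x ∈ σs.continuousCompatible)
    {O : DiscreteOrientation E} (hO : ∀ e, x e ∉ Set.Ioo (0 : ℝ) 1 → O.toReal e = x e) :
    σs.Compatible O := by
  intro d hd hdO
  by_contra hne
  obtain ⟨C, rfl | rfl⟩ := σs.eq_or_eq_neg hd
  · exact hne ⟨C, rfl⟩
  have hsign : ∀ e, σs.dir C e ≠ 0 → O.sign e = -σs.dir C e := fun e he => by
    simpa using hdO e (by simpa using he)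
  have hval := G.isElementarySystem_cocycle.values _ (σs.isDirectedCocycle C)
  -- The two copies of `E` hold the distances to the faces `x e = 0` and `x e = 1`. As `O` contains
  -- the reverse of `σs.dir C`, the move along `σs.dir C` points inwards at every face touched by
  -- `x`.
  obtain ⟨ε, hε, hpos⟩ := exists_pos_forall_add_mul_nonneg (ι := E ⊕ E)
    (α := Sum.elim x fun e => 1 - x e)
    (β := Sum.elim (fun e => (σs.dir C e : ℝ)) fun e => -(σs.dir C e : ℝ))
    (by
      rintro (e | e)
      · exact hx.1.1 e
      · exact sub_nonneg.2 (hx.1.2 e))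
    (by
      rintro (e | e) h
      · have h : x e = 0 := h
        have h1 := hO e (by rw [h]; simp)
        rw [O.toReal_eq, h] at h1
        have h2 : (O.sign e : ℝ) = -1 := by linarith
        change (0 : ℝ) ≤ σs.dir C e
        by_cases hC : σs.dir C e = 0
        · simp [hC]
        · rw [hsign e hC] at h2
          push_cast at h2
          linarith
      · have h : 1 - x e = 0 := h
        have h : x e = 1 := by linarith
        have h1 := hO e (by rw [h]; simp)
        rw [O.toReal_eq, h] at h1
        have h2 : (O.sign e : ℝ) = 1 := by linarith
        change (0 : ℝ) ≤ -(σs.dir C e : ℝ)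
        by_cases hC : σs.dir C e = 0
        · simp [hC]
        · rw [hsign e hC] at h2
          push_cast at h2
          linarith)
  refine hx.2 ε hε C ⟨fun e => hpos (Sum.inl e), fun e => ?_⟩
  have : 0 ≤ 1 - x e + ε * -(σs.dir C e : ℝ) := hpos (Sum.inr e)
  change x e + ε * (σs.dir C e : ℝ) ≤ 1
  linarith

end RefGraph

/-! ### Covering the cube by pigeonhole, and the conclusion -/

/-- If two orientations always differ at an edge that lies in exactly one of their images under
`φ`, then every point of the cube lies in a half-open cell. -/
theorem exists_mem_hoc_compl {E : Type*} [Finite E] (φ : DiscreteOrientation E → Set E)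
    (hφ : ∀ O O', (∀ e, O e ≠ O' e → (e ∈ φ O ↔ e ∈ φ O')) → O = O') {x : E → ℝ}
    (hx : x ∈ Set.Icc (0 : E → ℝ) 1) : ∃ O : DiscreteOrientation E, x ∈ O.hoc (φ O)ᶜ := by
  classical
  let R : (E → Bool) → DiscreteOrientation E := fun a e =>
    if x e ∈ Set.Ioo (0 : ℝ) 1 then a e else decide (x e = 1)
  have hR : ∀ a e, x e ∉ Set.Ioo (0 : ℝ) 1 → x e = (R a).toReal e := by
    intro a e he
    simp only [DiscreteOrientation.toReal, R, he, if_false, decide_eq_true_eq]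
    split_ifs with h
    · exact h
    · by_contra h0
      exact he ⟨lt_of_le_of_ne (hx.1 e) (Ne.symm h0), lt_of_le_of_ne (hx.2 e) h⟩
  -- On the bi-oriented edges `Ψ` records the image under `φ`; elsewhere it copies `a`, so that it
  -- is a self-map of a finite set. Being injective, it attains the constant `false`, which means
  -- that no bi-oriented edge lies in the image.
  let Ψ : (E → Bool) → (E → Bool) := fun a e =>
    if x e ∈ Set.Ioo (0 : ℝ) 1 then decide (e ∈ φ (R a)) else a e
  have hinj : Function.Injective Ψ := by
    intro a a' h
    have hRR : R a = R a' := by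
      refine hφ _ _ fun e he => ?_
      by_cases hxe : x e ∈ Set.Ioo (0 : ℝ) 1
      · have := congrFun h e
        simpa only [Ψ, if_pos hxe, decide_eq_decide] using this
      · exact absurd (by simp only [R, if_neg hxe]) he
    funext e
    by_cases hxe : x e ∈ Set.Ioo (0 : ℝ) 1
    · have := congrFun hRR e
      simpa only [R, if_pos hxe] using this
    · have := congrFun h e
      simpa only [Ψ, if_neg hxe] using this
  obtain ⟨a, ha⟩ := Finite.surjective_of_injective hinj fun _ => false
  refine ⟨R a, fun e he => ?_, fun e _ => ?_⟩
  · refine hR a e fun hxe => he fun hmem => ?_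
    have := congrFun ha e
    simp only [Ψ, if_pos hxe, decide_eq_false_iff_not] at this
    exact this hmem
  · by_cases hxe : x e ∈ Set.Ioo (0 : ℝ) 1
    · exact Or.inr hxe
    · exact Or.inl (hR a e hxe)

/-- For acyclic signatures `σ`, `σ*` of a finite connected graph, `φ_{σ,σ*}` is well defined, and
`S_{σ*}` is the disjoint union of the half-open cells `hoc(O, E ∖ φ_{σ,σ*}(O))` over the
`σ*`-compatible discrete orientations `O`. -/
theorem proposition4p12 {V E : Type*} [Finite V] [Fintype E] (G : RefGraph V E)
    (hG : G.Connected)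
    (σ : G.CycleSignature) (hσ : σ.IsAcyclic)
    (σs : G.CocycleSignature) (hσs : σs.IsAcyclic) :
    (∀ O : DiscreteOrientation E, ∃! S : Set E, RefGraph.IsPhiImage σ σs O S) ∧
    σs.continuousCompatible =
      ⋃ O ∈ {O : DiscreteOrientation E | σs.Compatible O}, O.hoc (RefGraph.phiDual σ σs O) ∧
    {O : DiscreteOrientation E | σs.Compatible O}.PairwiseDisjoint
      (fun O => O.hoc (RefGraph.phiDual σ σs O)) := by
  obtain ⟨w, hw⟩ := hσ.exists_weight
  obtain ⟨w', hw'⟩ := hσs.exists_weight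
  have horth : ∀ z ∈ G.cycleSpace, ∀ b ∈ G.cutSpace, z ⬝ᵥ b = 0 :=
    fun z hz b hb => G.dotProduct_eq_zero hz hb
  have hphi : ∀ O, RefGraph.IsPhiImage σ σs O (RefGraph.phi σ σs O) := fun O =>
    Classical.epsilon_spec (RefGraph.exists_isPhiImage hG hw hw' O)
  have hcert := fun O => (hphi O).exists_certificate hw hw'
  have hagree : ∀ O O' : DiscreteOrientation E, (∀ e, O e ≠ O' e →
      (e ∈ RefGraph.phi σ σs O ↔ e ∈ RefGraph.phi σ σs O')) → O = O' := fun O O' h => by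
    obtain ⟨C, -⟩ := hcert O
    obtain ⟨C', -⟩ := hcert O'
    exact (C.eq_of_agree horth C' h).1
  refine ⟨fun O => ⟨_, hphi O, fun S hS => ?_⟩, Set.Subset.antisymm ?_ ?_, ?_⟩
  · obtain ⟨C, -⟩ := hcert O
    obtain ⟨C', -⟩ := hS.exists_certificate hw hw'
    exact (C'.eq_of_agree horth C fun e he => absurd rfl he).2
  · intro x hx
    obtain ⟨O, hO⟩ := exists_mem_hoc_compl (RefGraph.phi σ σs) hagree hx.1
    refine Set.mem_biUnion (RefGraph.compatible_of_refines hx fun e he => ?_) hO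
    by_cases h : e ∈ (RefGraph.phi σ σs O)ᶜ
    · exact ((hO.2 e h).resolve_right he).symm
    · exact (hO.1 e h).symm
  · refine Set.iUnion₂_subset fun O hO => ?_
    obtain ⟨C, hC⟩ := hcert O
    exact RefGraph.hoc_subset_continuousCompatible hw' C (hC hO)
  · intro O _ O' _ hne
    refine Set.disjoint_left.2 fun x hx hx' => hne (hagree O O' fun e he => ?_)
    have hreal : O.toReal e ≠ O'.toReal e := by
      unfold DiscreteOrientation.toReal
      revert he
      cases O e <;> cases O' e <;> simp
    have hends : ∀ Q : DiscreteOrientation E, Q.toReal e ∉ Set.Ioo (0 : ℝ) 1 := fun Q => by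
      unfold DiscreteOrientation.toReal
      split_ifs <;> simp
    -- An edge of the image of `Q` is fixed in the direction of `Q`, which the cell of an oppositely
    -- directed `Q'` excludes. So orientations with a common point differ only outside both images.
    have key : ∀ Q Q' : DiscreteOrientation E, Q.toReal e ≠ Q'.toReal e →
        x ∈ Q.hoc (RefGraph.phiDual σ σs Q) → x ∈ Q'.hoc (RefGraph.phiDual σ σs Q') →
        e ∉ RefGraph.phi σ σs Q := by
      intro Q Q' hQ h h' hmem
      have h1 := h.1 e (not_not.2 hmem)
      by_cases h2 : e ∈ RefGraph.phiDual σ σs Q'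
      · rcases h'.2 e h2 with h3 | h3
        · exact hQ (h1.symm.trans h3)
        · exact hends Q (h1 ▸ h3)
      · exact hQ (h1.symm.trans (h'.1 e h2))
    exact iff_of_false (key O O' hreal hx hx') (key O' O hreal.symm hx' hx)
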